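/- Let $W$ be a finite Coxeter group with set of simple reflections $S$, length function $\ell$, sign character $\epsilon$ and reflection representation $V=\mathbb R^{S}$. For $J\subseteq S$ let $W_J=\langle J\rangle$, $X_J=\{w\in W:\ell(sw)>\ell(w)\ \forall s\in J\}$, $X_J^\sharp=\{x\in X_J: x^{-1}Jx\subseteq S\}$ and $x_J=\sum_{x\in X_J}x^{-1}\in\mathbb CW$. For $L \subseteq K\subseteq S$ put $m_{KL}=|X_K\cap X_L^\sharp|$, put $m_{KL}=0$ if $L\not\subseteq K$, and let $(e_L)_{L\subseteq S}$ be determined by $x_K=\sum_L m_{KL}e_L$. Let $\Phi_S$ be the character of the right $\mathbb CW$-module $e_S\mathbb CW$ (the top component of $\mathbb CW$). Let $A(W)$ be the Orlik–Solomon algebra of the reflection arrangement: it is generated over $\mathbb C$ by elements $a_t$, one for each reflection $t$, subject to $a_ta_{t'}=-a_{t'}a_t$ and $\sum_{i=1}^p(-1)^ia_{t_1}\cdots\widehat{a_{t_i}}\cdots a_{t_p}=0$ whenever the reflecting hyperplanes $H_{t_1},\dots,H_{t_p}$ are linearly dependent, and $W$ acts by $a_t.w=a_{w^{-1}tw}$.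 For an intersection $Y$ of reflecting hyperplanes of codimension $p$ let $A_Y$ be the span of the $a_{t_1}\cdots a_{t_p}$ with $H_{t_1}\cap\dots\cap H_{t_p}=Y$. Let $\Psi_S$ be the character of $W$ on the top component $A_{\{0\}}$. These constructions apply to every parabolic subgroup $W_L$, $L\subseteq S$, with simple reflections $L$ and reflection representation $V_L=\operatorname{span}(\alpha_s:s\in L)\subseteq V$, where $\alpha_s$ is the simple root of $s$; they give characters $\Phi_L$ and $\Psi_L$ of $W_L$. The characters $\Phi_L$ and $\Psi_L$ have the following extensions to $N_W(W_L)=W_L\rtimes N_L$, where $N_L=\{x\in X_L:x^{-1}Lx=L\}$. If $E_L$ is the top component of $\mathbb CW_L$, then $\widetilde\Phi_L$ is the character of $N_W(W_L)$, acting by right multiplication, on $x_LE_L\subseteq\mathbb CW$; equivalently, of $N_W(W_L)$ on $E_L$, where $un$ ($u\in W_L$, $n\in N_L$) acts by $a\mapsto n^{-1}aun$. And $\widetilde\Psi_L$ is the character of $N_W(W_L)$ on $A_Y\subseteq A(W)$, where $Y=\operatorname{Fix}(W_L)$. Let $\alpha_L(g)=\det(g|_{\operatorname{Fix}(W_L)})$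 for $g\in N_W(W_L)$. An element of $W_L$ is cuspidal if it fixes no nonzero vector of $V_L$. Let $\mathcal C_L$ be the set of conjugacy classes of $W_L$ that consist of cuspidal elements, and for each $C\in\mathcal C_L$ fix a representative $w_C\in C$; then $C_W(w_C)\le N_W(W_L)$. **Proposition.** Let $L\subseteq S$ and, for each $C\in\mathcal C_L$, let $\widetilde\varphi_{w_C}$ and $\widetilde\psi_{w_C}$ be linear characters of $C_W(w_C)$ such that (Conjecture C for $L\subseteq S$) 1. $\widetilde\Phi_L=\sum_{C\in\mathcal C_L}\operatorname{Ind}_{C_W(w_C)}^{N_W(W_L)}\widetilde\varphi_{w_C}$, 2. $\widetilde\Psi_L=\sum_{C\in\mathcal C_L}\operatorname{Ind}_{C_W(w_C)}^{N_W(W_L)}\widetilde\psi_{w_C}$, 3. $\widetilde\psi_{w_C}=\widetilde\varphi_{w_C}\,\epsilon\,\alpha_L$ for all $C\in\mathcal C_L$. Then the restrictions $\varphi_{w_C}=\operatorname{Res}^{C_W(w_C)}_{C_{W_L}(w_C)}\widetilde\varphi_{w_C}$ and $\psi_{w_C}=\operatorname{Res}^{C_W(w_C)}_{C_{W_L}(w_C)}\widetilde\psi_{w_C}$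 are linear characters that satisfy Conjecture B for the group $W_L$: 1. $\Phi_L=\sum_{C\in\mathcal C_L}\operatorname{Ind}_{C_{W_L}(w_C)}^{W_L}\varphi_{w_C}$, 2. $\Psi_L=\sum_{C\in\mathcal C_L}\operatorname{Ind}_{C_{W_L}(w_C)}^{W_L}\psi_{w_C}$, 3. $\psi_{w_C}=\varphi_{w_C}\,\epsilon$ for all $C\in\mathcal C_L$. -/

import Mathlib

noncomputable section

namespace FinCoxeter

open scoped Classical in
/-- The class function on `G` induced from a function `f` on the subgroup `H`:
`(Ind f)(g) = |H|⁻¹ ∑_{x ∈ G, x g x⁻¹ ∈ H} f (x g x⁻¹)`. -/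
def ind {G : Type*} [Group G] (H : Subgroup G) (f : H → ℂ) (g : G) : ℂ :=
  (Nat.card H : ℂ)⁻¹ * ∑ᶠ x : G, if h : x * g * x⁻¹ ∈ H then f ⟨x * g * x⁻¹, h⟩ else 0

/-! ### The descent algebra of a group `G` with generators `s i`, `i : B`

Everything here is applied to a finite Coxeter group with its simple reflections. -/

section Descent

variable {G B : Type*} [Group G] (s : B → G)

/-- The length of `g`: the least length of a word in the generators with product `g`. -/
def wordLength (g : G) : ℕ :=
  sInf {n | ∃ ω : List B, ω.length = n ∧ (ω.map s).prod = g}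

/-- The sign character `g ↦ (-1) ^ ℓ(g)`. -/
def sign (g : G) : ℂ := (-1) ^ wordLength s g

/-- `X_J`, the minimal length representatives of the right cosets of `⟨s i : i ∈ J⟩`. -/
def X (J : Finset B) : Set G :=
  {w | ∀ i ∈ J, wordLength s w < wordLength s (s i * w)}

/-- `X_J^♯`, the elements `x` of `X_J` such that `x⁻¹ J x ⊆ S`. -/
def Xsharp (J : Finset B) : Set G :=
  {x | x ∈ X s J ∧ ∀ i ∈ J, ∃ k, x⁻¹ * s i * x = s k}

/-- `x_J = ∑_{x ∈ X_J} x⁻¹` in the group algebra. -/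
def xElt (J : Finset B) : MonoidAlgebra ℂ G :=
  ∑ᶠ x ∈ X s J, MonoidAlgebra.single x⁻¹ (1 : ℂ)

open scoped Classical in
/-- The matrix `m_{KL} = |X_K ∩ X_L^♯|` if `L ⊆ K`, and `0` otherwise. -/
def mMatrix : Matrix (Finset B) (Finset B) ℂ :=
  fun K L => if L ⊆ K then (Nat.card ↥(X s K ∩ Xsharp s L) : ℂ) else 0

open scoped Classical in
/-- The elements `e_L` determined by `x_K = ∑_L m_{KL} e_L`. -/
def eElt [Fintype B] (L : Finset B) : MonoidAlgebra ℂ G :=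
  ∑ K : Finset B, (mMatrix s)⁻¹ L K • xElt s K

/-- The operator of right multiplication by the group element `g` on the group algebra. -/
def rightMul (g : G) : MonoidAlgebra ℂ G →ₗ[ℂ] MonoidAlgebra ℂ G :=
  LinearMap.mulRight ℂ (MonoidAlgebra.single g (1 : ℂ))

/-- The subspace `u · ℂH` of `ℂG`, for `u ∈ ℂG` and a subgroup `H` of `G`. -/
def cyclicSub (u : MonoidAlgebra ℂ G) (H : Subgroup G) : Submodule ℂ (MonoidAlgebra ℂ G) :=
  Submodule.span ℂ ((fun h : G => u * MonoidAlgebra.single h (1 : ℂ)) '' (H : Set G))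

theorem rightMul_mem_cyclicSub (u : MonoidAlgebra ℂ G) (H : Subgroup G) (g : H) :
    ∀ a ∈ cyclicSub u H, rightMul (g : G) a ∈ cyclicSub u H := by
  intro a ha
  have h : cyclicSub u H ≤ (cyclicSub u H).comap (rightMul (g : G)) := by
    refine Submodule.span_le.2 ?_
    rintro _ ⟨k, hk, rfl⟩
    refine Submodule.subset_span ⟨k * g, H.mul_mem hk g.2, ?_⟩
    simp [rightMul, mul_assoc, MonoidAlgebra.single_mul_single]
  exact h ha

/-- The character of the right `ℂH`-module `u · ℂH`. -/
def cyclicChar (u : MonoidAlgebra ℂ G) (H : Subgroup G) (g : H) : ℂ :=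
  LinearMap.trace ℂ (cyclicSub u H)
    ((rightMul (g : G)).restrict (rightMul_mem_cyclicSub u H g))

/-- The character `Φ_S` of the top component `e_S · ℂG` of the group algebra. -/
def Phi [Fintype B] (g : G) : ℂ :=
  cyclicChar (eElt s Finset.univ) (⊤ : Subgroup G) ⟨g, Subgroup.mem_top g⟩

end Descent

/-! ### Fixed spaces, cuspidal classes and the Orlik-Solomon algebra

Everything here is applied to a finite Coxeter group with its reflection representation `ρ`. -/

section Reflection

variable {G B V : Type*} [Group G] [AddCommGroup V] [Module ℝ V]

/-- `Fix(g)`. -/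
def fixedSpace (ρ : Representation ℝ G V) (g : G) : Submodule ℝ V :=
  LinearMap.ker (ρ g - 1)

/-- `Fix(H)`, for a subgroup `H`. -/
def fixedBy (ρ : Representation ℝ G V) (H : Subgroup G) : Submodule ℝ V :=
  ⨅ h : H, fixedSpace ρ (h : G)

/-- An element is cuspidal if it fixes no nonzero vector. -/
def IsCuspidal (ρ : Representation ℝ G V) (g : G) : Prop :=
  fixedSpace ρ g = ⊥

/-- The cuspidal conjugacy classes. -/
def CuspidalClass (ρ : Representation ℝ G V) : Type _ :=
  {C : ConjClasses G // ∀ g ∈ C.carrier, IsCuspidal ρ g}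

theorem mem_fixedSpace {ρ : Representation ℝ G V} {g : G} {v : V} :
    v ∈ fixedSpace ρ g ↔ ρ g v = v := by
  simp [fixedSpace, sub_eq_zero]

theorem mem_fixedBy {ρ : Representation ℝ G V} {H : Subgroup G} {v : V} :
    v ∈ fixedBy ρ H ↔ ∀ h ∈ H, ρ h v = v := by
  simp [fixedBy, mem_fixedSpace]

theorem rep_inv_apply (ρ : Representation ℝ G V) (g : G) (v : V) : ρ g⁻¹ (ρ g v) = v := by
  rw [← Module.End.mul_apply, ← map_mul]; simp

theorem rep_apply_inv (ρ : Representation ℝ G V) (g : G) (v : V) : ρ g (ρ g⁻¹ v) = v := by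
  rw [← Module.End.mul_apply, ← map_mul]; simp

theorem rep_mem_fixedBy (ρ : Representation ℝ G V) (H : Subgroup G)
    (n : Subgroup.normalizer (H : Set G)) :
    ∀ v ∈ fixedBy ρ H, ρ (n : G) v ∈ fixedBy ρ H := by
  intro v hv
  rw [mem_fixedBy] at hv ⊢
  intro h hh
  have h1 : (n : G)⁻¹ * h * n ∈ H := by
    have := (Subgroup.mem_normalizer_iff''.1 n.2 h).1 hh
    simpa using this
  have h2 := hv _ h1
  rw [map_mul, map_mul, Module.End.mul_apply, Module.End.mul_apply] at h2
  have h3 := congrArg (ρ (n : G)) h2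
  rwa [rep_apply_inv] at h3

theorem map_fixedBy (ρ : Representation ℝ G V) (H : Subgroup G)
    (n : Subgroup.normalizer (H : Set G)) :
    (fixedBy ρ H).map (ρ (n : G)) = fixedBy ρ H := by
  apply le_antisymm
  · rintro _ ⟨v, hv, rfl⟩
    exact rep_mem_fixedBy ρ H n v hv
  · intro v hv
    exact ⟨ρ (n : G)⁻¹ v, rep_mem_fixedBy ρ H n⁻¹ v hv, rep_apply_inv ρ _ v⟩

/-- The character `n ↦ det (n | Fix(H))` of the normalizer of `H`. -/
def alpha (ρ : Representation ℝ G V) (H : Subgroup G)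
    (n : Subgroup.normalizer (H : Set G)) : ℂ :=
  ((LinearMap.det ((ρ (n : G)).restrict (rep_mem_fixedBy ρ H n)) : ℝ) : ℂ)

/-- The set `T` of reflections, i.e., of conjugates of the generators. -/
def Refl (s : B → G) : Type _ := {t : G // ∃ (i : B) (g : G), t = g⁻¹ * s i * g}

/-- `t ^ g = g⁻¹ t g` for a reflection `t`. -/
def Refl.conj {s : B → G} (t : Refl s) (g : G) : Refl s :=
  ⟨g⁻¹ * t.1 * g, by
    obtain ⟨i, h, hh⟩ := t.2
    exact ⟨i, h * g, by rw [hh]; group⟩⟩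

variable (s : B → G) (ρ : Representation ℝ G V)

/-- The intersection `H_{t_1} ∩ ⋯ ∩ H_{t_p}` of the reflecting hyperplanes of a list of
reflections. -/
def flat (l : List (Refl s)) : Submodule ℝ V :=
  ⨅ t ∈ l, fixedSpace ρ t.1

/-- The list `H_{t_1}, …, H_{t_p}` of hyperplanes is linearly dependent: the codimension of its
intersection is less than `p`. -/
def IsDependent (l : List (Refl s)) : Prop :=
  Module.finrank ℝ V < Module.finrank ℝ (flat s ρ l) + l.length

/-- The monomial `a_{t_1} ⋯ a_{t_p}` in the free algebra. -/
def monomial (l : List (Refl s)) : FreeAlgebra ℂ (Refl s) :=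
  (l.map (FreeAlgebra.ι ℂ)).prod

/-- `∑_{i=1}^p (-1)^i a_{t_1} ⋯ a_{t_{i-1}} a_{t_{i+1}} ⋯ a_{t_p}`. -/
def boundary (l : List (Refl s)) : FreeAlgebra ℂ (Refl s) :=
  ∑ i ∈ Finset.range l.length, (-1 : ℂ) ^ (i + 1) • monomial s (l.eraseIdx i)

/-- The defining relations of the Orlik-Solomon algebra. -/
inductive OSRel : FreeAlgebra ℂ (Refl s) → FreeAlgebra ℂ (Refl s) → Prop
  | anticomm (t t' : Refl s) : OSRel (monomial s [t, t']) (-monomial s [t', t])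
  | dependent (l : List (Refl s)) (h : IsDependent s ρ l) : OSRel (boundary s l) 0

/-- The Orlik-Solomon algebra of the reflection arrangement. -/
abbrev OSAlgebra : Type _ := RingQuot (OSRel s ρ)

/-- The image of the monomial `a_{t_1} ⋯ a_{t_p}` in the Orlik-Solomon algebra. -/
def osMonomial (l : List (Refl s)) : OSAlgebra s ρ :=
  RingQuot.mkAlgHom ℂ (OSRel s ρ) (monomial s l)

/-- The endomorphism `a_t ↦ a_{t ^ g}` of the free algebra. -/
def freeAct (g : G) : FreeAlgebra ℂ (Refl s) →ₐ[ℂ] FreeAlgebra ℂ (Refl s) :=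
  FreeAlgebra.lift ℂ fun t => FreeAlgebra.ι ℂ (t.conj g)

theorem freeAct_monomial (g : G) (l : List (Refl s)) :
    freeAct s g (monomial s l) = monomial s (l.map fun t => t.conj g) := by
  simp [freeAct, monomial, map_list_prod, Function.comp_def]

theorem freeAct_boundary (g : G) (l : List (Refl s)) :
    freeAct s g (boundary s l) = boundary s (l.map fun t => t.conj g) := by
  simp [boundary, map_sum, freeAct_monomial, List.eraseIdx_map]

theorem fixedSpace_conj (g t : G) :
    fixedSpace ρ (g⁻¹ * t * g) = (fixedSpace ρ t).comap (ρ g) := by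
  ext v
  rw [Submodule.mem_comap, mem_fixedSpace, mem_fixedSpace, map_mul, map_mul,
    Module.End.mul_apply, Module.End.mul_apply]
  constructor
  · intro h
    have := congrArg (ρ g) h
    rwa [rep_apply_inv] at this
  · intro h
    rw [h, rep_inv_apply]

theorem flat_conj (g : G) (l : List (Refl s)) :
    flat s ρ (l.map fun t => t.conj g) = (flat s ρ l).comap (ρ g) := by
  ext v
  simp only [flat, Submodule.mem_iInf, Submodule.mem_comap, List.forall_mem_map]
  refine forall₂_congr fun t _ => ?_
  rw [Refl.conj, fixedSpace_conj, Submodule.mem_comap]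

theorem comap_rep (g : G) (Y : Submodule ℝ V) : Y.comap (ρ g) = Y.map (ρ g⁻¹) := by
  ext v
  constructor
  · intro h
    exact ⟨ρ g v, h, rep_inv_apply ρ g v⟩
  · rintro ⟨w, hw, rfl⟩
    simpa [rep_apply_inv] using hw

theorem rep_injective (g : G) : Function.Injective (ρ g) :=
  Function.LeftInverse.injective (rep_inv_apply ρ g)

theorem finrank_comap (g : G) (Y : Submodule ℝ V) :
    Module.finrank ℝ (Y.comap (ρ g)) = Module.finrank ℝ Y := by
  rw [comap_rep]
  exact (Submodule.equivMapOfInjective (ρ g⁻¹) (rep_injective ρ g⁻¹) Y).finrank_eq.symm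

/-- The right action `a_t . g = a_{t ^ g}` of `g` on the Orlik-Solomon algebra. -/
def osAct (g : G) : OSAlgebra s ρ →ₐ[ℂ] OSAlgebra s ρ :=
  RingQuot.liftAlgHom ℂ ⟨(RingQuot.mkAlgHom ℂ (OSRel s ρ)).comp (freeAct s g), by
    intro x y h
    rw [AlgHom.comp_apply, AlgHom.comp_apply]
    cases h with
    | anticomm t t' =>
      rw [map_neg, freeAct_monomial, freeAct_monomial]
      exact RingQuot.mkAlgHom_rel ℂ (OSRel.anticomm _ _)
    | dependent l h =>
      rw [map_zero, freeAct_boundary]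
      refine RingQuot.mkAlgHom_rel ℂ (OSRel.dependent _ ?_)
      rw [IsDependent, flat_conj, finrank_comap, List.length_map]
      exact h⟩

theorem osAct_osMonomial (g : G) (l : List (Refl s)) :
    osAct s ρ g (osMonomial s ρ l) = osMonomial s ρ (l.map fun t => t.conj g) := by
  rw [osAct, osMonomial, RingQuot.liftAlgHom_mkAlgHom_apply, AlgHom.comp_apply,
    freeAct_monomial]
  rfl

/-- The component `A_Y`, spanned by the `a_{t_1} ⋯ a_{t_p}` with `p = codim Y` and
`H_{t_1} ∩ ⋯ ∩ H_{t_p} = Y`. For `Y = 0` it is the top component. -/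
def osComponent (Y : Submodule ℝ V) : Submodule ℂ (OSAlgebra s ρ) :=
  Submodule.span ℂ {a | ∃ l : List (Refl s),
    flat s ρ l = Y ∧ l.length + Module.finrank ℝ Y = Module.finrank ℝ V ∧ a = osMonomial s ρ l}

theorem osAct_mem_osComponent (Y : Submodule ℝ V) (g : G) (h : Y.map (ρ g) = Y) :
    ∀ a ∈ osComponent s ρ Y, (osAct s ρ g).toLinearMap a ∈ osComponent s ρ Y := by
  intro a ha
  have key : osComponent s ρ Y ≤ (osComponent s ρ Y).comap (osAct s ρ g).toLinearMap := by
    refine Submodule.span_le.2 ?_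
    rintro _ ⟨l, hl, hp, rfl⟩
    refine Submodule.subset_span ⟨l.map fun t => t.conj g, ?_, ?_, ?_⟩
    · rw [flat_conj, hl]
      conv_lhs => rw [← h]
      exact Submodule.comap_map_eq_of_injective (rep_injective ρ g) Y
    · rw [List.length_map, hp]
    · exact osAct_osMonomial s ρ g l
  exact key ha

/-- The trace of `g` on `A_Y`, for `g` stabilizing `Y`. -/
def osChar (Y : Submodule ℝ V) (g : G) (h : Y.map (ρ g) = Y) : ℂ :=
  LinearMap.trace ℂ (osComponent s ρ Y)
    ((osAct s ρ g).toLinearMap.restrict (osAct_mem_osComponent s ρ Y g h))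

/-- The character `Ψ_S` of the top component of the Orlik-Solomon algebra. -/
def Psi (g : G) : ℂ := osChar s ρ ⊥ g (Submodule.map_bot _)

/-- For the Coxeter group `G` with simple reflections `s` and reflection representation `ρ`,
the linear characters `φ C` and `ψ C` of the centralizers of the representatives `w C` of the
cuspidal classes `C` decompose the top characters `Φ_S` and `Ψ_S`, with `ψ C = φ C · ε`. -/
structure SatisfiesB [Fintype B] (w : CuspidalClass ρ → G)
    (φ ψ : ∀ C, Subgroup.centralizer {w C} →* ℂˣ) : Prop where
  phi : ∀ g : G, Phi s g =
    ∑ᶠ C, ind (Subgroup.centralizer {w C}) (fun c => (φ C c : ℂ)) g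
  psi : ∀ g : G, Psi s ρ g =
    ∑ᶠ C, ind (Subgroup.centralizer {w C}) (fun c => (ψ C c : ℂ)) g
  twist : ∀ C, ∀ c : Subgroup.centralizer {w C},
    (ψ C c : ℂ) = (φ C c : ℂ) * sign s (c : G)

end Reflection

/-! ### The reflection representation of a Coxeter group -/

section Geometric

open Polynomial Polynomial.Chebyshev Real

variable {B W : Type*} [Fintype B] [DecidableEq B] [Group W] {M : CoxeterMatrix B}

/-- The simple root `α_i`, a standard basis vector of `ℝ^B`. -/
def root (i : B) : B → ℝ := Pi.single i 1

/-- The linear form `v ↦ 2 ⟨α_i, v⟩`, for the bilinear form with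
`⟨α_i, α_j⟩ = -cos (π / m_{ij})`. -/
def coroot (M : CoxeterMatrix B) (i : B) : Module.Dual ℝ (B → ℝ) :=
  ∑ j, (-2 * cos (π / M i j)) • LinearMap.proj j

theorem coroot_root (M : CoxeterMatrix B) (i j : B) :
    coroot M i (root j) = -2 * cos (π / M i j) := by
  simp [coroot, root, Pi.single_apply]

theorem coroot_root_self (M : CoxeterMatrix B) (i : B) : coroot M i (root i) = 2 := by
  rw [coroot_root]; simp

/-- The reflection `v ↦ v - 2 ⟨α_i, v⟩ α_i`. -/
def simpleReflection (M : CoxeterMatrix B) (i : B) : (B → ℝ) ≃ₗ[ℝ] (B → ℝ) :=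
  Module.reflection (coroot_root_self M i)

theorem chebyshev_vanish (m : ℕ) (hm : 3 ≤ m) (t : ℝ) (ht : t = 2 * cos (2 * π / m)) :
    ((S ℝ (((m : ℤ) - 2) / 2)).eval t *
      ((S ℝ (((m : ℤ) - 1) / 2)).eval t + (S ℝ (((m : ℤ) - 3) / 2)).eval t) = 0) ∧
    ((S ℝ (((m : ℤ) - 1) / 2)).eval t *
      ((S ℝ ((m : ℤ) / 2)).eval t + (S ℝ (((m : ℤ) - 2) / 2)).eval t) = 0) := by
  have hm0 : (m : ℝ) ≠ 0 := by positivity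
  have hsin : sin (2 * π / m) ≠ 0 := by
    apply ne_of_gt
    apply sin_pos_of_pos_of_lt_pi
    · positivity
    · rw [div_lt_iff₀ (by positivity)]
      have : (3 : ℝ) ≤ m := by exact_mod_cast hm
      nlinarith [pi_pos]
  have hS : ∀ n : ℤ, (S ℝ n).eval t * sin (2 * π / m) = sin ((n + 1) * (2 * π / m)) := by
    intro n; rw [ht]; exact S_two_mul_real_cos _ n
  rcases Nat.even_or_odd' m with ⟨k, hk | hk⟩
  · have h1 : (S ℝ ((k : ℤ) - 1)).eval t = 0 := by
      have := hS ((k : ℤ) - 1)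
      have e : (((k : ℤ) - 1 : ℤ) + 1 : ℝ) * (2 * π / m) = π := by
        have hk0 : (k : ℝ) ≠ 0 := by rintro h; apply hm0; rw [hk]; push_cast; rw [h]; simp
        rw [hk]; push_cast; field_simp; ring
      rw [e, sin_pi] at this
      exact (mul_eq_zero.1 this).resolve_right hsin
    have e1 : ((m : ℤ) - 2) / 2 = k - 1 := by omega
    have e2 : ((m : ℤ) - 1) / 2 = k - 1 := by omega
    rw [e1, e2, h1]; simp
  · have h1 : (S ℝ (k : ℤ)).eval t + (S ℝ ((k : ℤ) - 1)).eval t = 0 := by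
      have a := hS (k : ℤ)
      have b := hS ((k : ℤ) - 1)
      have e : (((k : ℤ) : ℝ) + 1) * (2 * π / m) =
          2 * π - (((k : ℤ) - 1 : ℤ) + 1 : ℝ) * (2 * π / m) := by
        push_cast; rw [hk] at hm0 ⊢; push_cast at hm0 ⊢; field_simp; ring
      rw [e, sin_two_pi_sub] at a
      have : ((S ℝ (k : ℤ)).eval t + (S ℝ ((k : ℤ) - 1)).eval t) * sin (2 * π / m) = 0 := by
        linear_combination a + b
      exact (mul_eq_zero.1 this).resolve_right hsin
    have e1 : ((m : ℤ) - 1) / 2 = k := by omega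
    have e2 : ((m : ℤ) - 3) / 2 = k - 1 := by omega
    have e3 : (m : ℤ) / 2 = k := by omega
    have e4 : ((m : ℤ) - 2) / 2 = k - 1 := by omega
    rw [e1, e2, e3, e4, h1]; simp

theorem simpleReflection_relation (M : CoxeterMatrix B) (i j : B) :
    (simpleReflection M i * simpleReflection M j) ^ M i j = 1 := by
  by_cases hij : i = j
  · subst hij
    rw [M.diagonal, pow_one]
    ext1 v
    exact Module.involutive_reflection (coroot_root_self M i) v
  have h1 : M i j ≠ 1 := M.off_diagonal i j hij
  have hsym : M j i = M i j := M.symmetric j i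
  rcases Nat.lt_or_ge (M i j) 3 with hlt | hge
  · interval_cases hM : M i j
    · rfl
    · exact absurd rfl h1
    · ext1 v
      rw [simpleReflection, simpleReflection, Module.reflection_mul_reflection_pow_apply]
      have a : coroot M i (root j) = 0 := by rw [coroot_root, hM]; simp
      have b : coroot M j (root i) = 0 := by rw [coroot_root, hsym]; simp
      simp [a, b]
      module
  · ext1 v
    have ht : (2 * cos (2 * π / M i j) : ℝ) =
        coroot M i (root j) * coroot M j (root i) - 2 := by
      rw [coroot_root, coroot_root, hsym, mul_div_assoc, cos_two_mul]; ring
    rw [simpleReflection, simpleReflection,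
      Module.reflection_mul_reflection_pow_apply _ _ _ _ _ ht]
    obtain ⟨c, d⟩ := chebyshev_vanish (M i j) hge _ rfl
    rw [c, d]; simp

theorem simpleReflection_liftable (M : CoxeterMatrix B) :
    M.IsLiftable (G := Module.End ℝ (B → ℝ)) fun i => (simpleReflection M i).toLinearMap := by
  intro i j
  have key : ∀ n : ℕ, (((simpleReflection M i).toLinearMap *
      (simpleReflection M j).toLinearMap : Module.End ℝ (B → ℝ)) ^ n) =
      ((simpleReflection M i * simpleReflection M j) ^ n).toLinearMap := by
    intro n
    induction n with
    | zero => rfl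
    | succ n ih => rw [pow_succ, pow_succ, ih]; rfl
  rw [key, simpleReflection_relation]; rfl

/-- The reflection representation of a Coxeter group on `V = ℝ^B`. -/
def geomRep (cs : CoxeterSystem M W) : Representation ℝ W (B → ℝ) :=
  cs.lift ⟨fun i => (simpleReflection M i).toLinearMap, simpleReflection_liftable M⟩

theorem geomRep_simple (cs : CoxeterSystem M W) (i : B) (v : B → ℝ) :
    geomRep cs (cs.simple i) v = v - coroot M i v • root i := by
  have h := cs.lift_apply_simple (f := fun i => (simpleReflection M i).toLinearMap)
    (simpleReflection_liftable M) i
  rw [geomRep, h]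
  exact Module.reflection_apply v (coroot_root_self M i)

/-! ### Standard parabolic subgroups -/

/-- The parabolic subgroup `W_L`. -/
def parabolic (cs : CoxeterSystem M W) (L : Finset B) : Subgroup W :=
  Subgroup.closure (cs.simple '' (L : Set B))

/-- The simple reflections of `W_L`. -/
def parabolicSimple (cs : CoxeterSystem M W) (L : Finset B) (i : L) : parabolic cs L :=
  ⟨cs.simple i, Subgroup.subset_closure ⟨i, i.2, rfl⟩⟩

/-- The subspace `V_L` of `V` spanned by the simple roots `α_i`, `i ∈ L`. -/
def parabolicSpace (L : Finset B) : Submodule ℝ (B → ℝ) :=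
  Submodule.span ℝ (root '' (L : Set B))

theorem geomRep_mem_parabolicSpace (cs : CoxeterSystem M W) (L : Finset B)
    (w : parabolic cs L) :
    ∀ v ∈ parabolicSpace L, geomRep cs (w : W) v ∈ parabolicSpace L := by
  obtain ⟨w, hw⟩ := w
  have hsimple : ∀ i ∈ L, ∀ v ∈ parabolicSpace L,
      geomRep cs (cs.simple i) v ∈ parabolicSpace L := by
    intro i hi v hv
    rw [geomRep_simple]
    exact Submodule.sub_mem _ hv
      (Submodule.smul_mem _ _ (Submodule.subset_span ⟨i, hi, rfl⟩))
  change ∀ v ∈ parabolicSpace L, geomRep cs w v ∈ parabolicSpace L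
  induction hw using Subgroup.closure_induction'' with
  | one => intro v hv; simpa using hv
  | mem x hx => obtain ⟨i, hi, rfl⟩ := hx; exact hsimple i hi
  | inv_mem x hx =>
    obtain ⟨i, hi, rfl⟩ := hx
    rw [cs.inv_simple]; exact hsimple i hi
  | mul x y _ _ hx hy =>
    intro v hv
    rw [map_mul, Module.End.mul_apply]
    exact hx _ (hy _ hv)

/-- The reflection representation of `W_L`, on the subspace `V_L` of `V`. -/
def parabolicRep (cs : CoxeterSystem M W) (L : Finset B) :
    Representation ℝ (parabolic cs L) (parabolicSpace L) where
  toFun w := (geomRep cs (w : W)).restrict (geomRep_mem_parabolicSpace cs L w)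
  map_one' := by ext1 v; apply Subtype.ext; simp
  map_mul' x y := by ext1 v; apply Subtype.ext; simp

/-- The normalizer `N_W(W_L)`. -/
abbrev parabolicNormalizer (cs : CoxeterSystem M W) (L : Finset B) : Subgroup W :=
  Subgroup.normalizer (parabolic cs L : Set W)

/-- The extension of `Φ_L` to `N_W(W_L)`. Let `E_L = e · ℂW_L` be the top component of `ℂW_L`.
Then `x_L · E_L = x_L · e · ℂN_W(W_L)` is stable under right multiplication by `N_W(W_L)`, and
this is its character. (The map `a ↦ x_L a` identifies `x_L · E_L` with `E_L`, on which
`u n`, with `u ∈ W_L` and `n ∈ N_L`, acts by `a ↦ n⁻¹ a u n`.) -/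
def PhiTilde (cs : CoxeterSystem M W) (L : Finset B) (g : parabolicNormalizer cs L) : ℂ :=
  cyclicChar (xElt cs.simple L *
      MonoidAlgebra.mapDomainAlgHom ℂ ℂ (parabolic cs L).subtype
        (eElt (parabolicSimple cs L) Finset.univ))
    (parabolicNormalizer cs L) g

/-- The extension of `Ψ_L` to `N_W(W_L)`: the character of the component `A_Y` of `A(W)`,
where `Y = Fix(W_L)`. -/
def PsiTilde (cs : CoxeterSystem M W) (L : Finset B) (g : parabolicNormalizer cs L) : ℂ :=
  osChar cs.simple (geomRep cs) (fixedBy (geomRep cs) (parabolic cs L)) (g : W)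
    (map_fixedBy (geomRep cs) (parabolic cs L) g)

/-- The function on `C_W(w) ∩ N_W(W_L)`, viewed as a subgroup of `N_W(W_L)`, given by a linear
character of `C_W(w)`. (If `w` is cuspidal in `W_L`, then `C_W(w) ≤ N_W(W_L)`.) -/
def toNormalizer (cs : CoxeterSystem M W) (L : Finset B) {w : W}
    (χ : Subgroup.centralizer {w} →* ℂˣ)
    (c : (Subgroup.centralizer {w}).subgroupOf (parabolicNormalizer cs L)) : ℂ :=
  (χ ⟨((c : parabolicNormalizer cs L) : W), Subgroup.mem_subgroupOf.1 c.2⟩ : ℂ)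

/-- For the subset `L` of `S`, the linear characters `φ C` and `ψ C` of the centralizers in `W` of
the representatives `w C` of the cuspidal classes `C` of `W_L` decompose the extensions of `Φ_L`
and `Ψ_L` to `N_W(W_L)`, with `ψ C = φ C · ε · α_L`. -/
structure SatisfiesC (cs : CoxeterSystem M W) (L : Finset B)
    (w : CuspidalClass (parabolicRep cs L) → parabolic cs L)
    (φ ψ : ∀ C, Subgroup.centralizer {(w C : W)} →* ℂˣ) : Prop where
  phi : ∀ g : parabolicNormalizer cs L, PhiTilde cs L g =
    ∑ᶠ C, ind ((Subgroup.centralizer {(w C : W)}).subgroupOf (parabolicNormalizer cs L))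
      (toNormalizer cs L (φ C)) g
  psi : ∀ g : parabolicNormalizer cs L, PsiTilde cs L g =
    ∑ᶠ C, ind ((Subgroup.centralizer {(w C : W)}).subgroupOf (parabolicNormalizer cs L))
      (toNormalizer cs L (ψ C)) g
  twist : ∀ C, ∀ c : Subgroup.centralizer {(w C : W)},
    ∀ hc : (c : W) ∈ parabolicNormalizer cs L,
      (ψ C c : ℂ) = (φ C c : ℂ) * sign cs.simple (c : W) *
        alpha (geomRep cs) (parabolic cs L) ⟨(c : W), hc⟩

end Geometric

/-- The inclusion `C_H(w) → C_G(w)`, for `w` in a subgroup `H` of `G`. -/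
def centralizerInclusion {G : Type*} [Group G] {H : Subgroup G} (w : H) :
    Subgroup.centralizer {w} →* Subgroup.centralizer {(w : G)} where
  toFun c := ⟨((c : H) : G), by
    have h := Subgroup.mem_centralizer_singleton_iff.1 c.2
    exact Subgroup.mem_centralizer_singleton_iff.2 (congrArg Subtype.val h)⟩
  map_one' := rfl
  map_mul' _ _ := rfl

end FinCoxeter

end

/-! Write N for N_W(W_L) and Y for Fix(W_L). The claim is the restriction of the two character
identities from N to W_L, so two things are needed: the extended characters restrict to the top
characters of W_L, and each induced character restricts to the corresponding induced character of
W_L.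

Left-hand sides. The map a ↦ x_L a embeds ℂW_L in ℂW and commutes with right multiplication by W_L.
It carries e·ℂW_L onto x_L e·ℂN, because N is W_L times a set of elements n that permute the simple
root rays of L, and such n satisfy x_L n = x_L and n e = e n (`PhiTilde_eq_Phi`). The Orlik–Solomon
algebra of W_L embeds in A(W), split by the map that kills the reflections outside W_L, and its top
component goes onto A_Y (`PsiTilde_eq_Psi`).

Right-hand sides. By Mackey's formula the restriction of Ind from C_W(w_C) to N is the single term
Ind from C_{W_L}(w_C) to W_L, provided that N = C_W(w_C) W_L. This factorization is extracted from
the hypothesis on Ψ by comparing degrees (`SatisfiesC.exists_eq_mul`): dim A_Y = ∑ [N : C_W(w_C)] ≥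
∑ [W_L : C_{W_L}(w_C)] ≥ ∑ |C| ≥ #{w : Fix(w) = Y} ≥ dim A_Y. Equality in each summand of the first
inequality is the factorization. The third inequality says that elements with fixed space Y are
cuspidal elements of W_L (`card_fixedSpace_eq_le`). The last (`finrank_osComponent_le`) is an
induction on codimension: multiplication by a_t in A(W) is matched by right multiplication by t in
W.

The twist restricts because ε of W restricts to ε of W_L and α_L is trivial on W_L. The geometric
input throughout is that w sends each simple root to a nonnegative or a nonpositive vector,
according to whether it is a right descent of w (`geomRep_root_nonneg`). -/

noncomputable section

namespace FinCoxeter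

/-! ### Positive roots and descents; faithfulness of the reflection representation -/

section Positivity

open Real

variable {B W : Type*} [Fintype B] [DecidableEq B] [Group W] {M : CoxeterMatrix B}

/-- The values `sin (k π / m) / sin (π / m)`, with `k` for `m = 0`, satisfy the Chebyshev recursion
and are nonnegative for `k ≤ m`. -/
theorem exists_chebyshev_seq (m : ℕ) (hm : m ≠ 1) :
    ∃ U : ℕ → ℝ, U 0 = 0 ∧ U 1 = 1 ∧
      (∀ k, U (k + 2) = 2 * cos (π / m) * U (k + 1) - U k) ∧
      ∀ k, (m ≠ 0 → k ≤ m) → 0 ≤ U k := by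
  rcases Nat.eq_zero_or_pos m with rfl | hpos
  -- Here m = 0 stands for infinite order. As π / 0 = 0, the coefficient of the recursion is 2.
  · exact ⟨fun k => k, by simp, by simp, fun k => by simp; ring, fun k _ => by positivity⟩
  · have hm2 : (2 : ℝ) ≤ m := by exact_mod_cast (by omega : 2 ≤ m)
    have hs : 0 < sin (π / m) := by
      apply sin_pos_of_pos_of_lt_pi
      · positivity
      · rw [div_lt_iff₀ (by positivity)]
        nlinarith [pi_pos]
    refine ⟨fun k => sin (k * (π / m)) / sin (π / m), by simp, by simp [hs.ne'], fun k => ?_,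
      fun k hk => ?_⟩
    · have e1 : ((k + 2 : ℕ) : ℝ) * (π / m) = ((k + 1 : ℕ) : ℝ) * (π / m) + π / m := by
        push_cast; ring
      have e2 : (k : ℝ) * (π / m) = ((k + 1 : ℕ) : ℝ) * (π / m) - π / m := by push_cast; ring
      beta_reduce
      rw [e1, e2, sin_add, sin_sub]
      ring
    · refine div_nonneg (sin_nonneg_of_nonneg_of_le_pi (by positivity) ?_) hs.le
      have hk' : (k : ℝ) ≤ m := by exact_mod_cast hk (by omega)
      have : (m : ℝ) ≠ 0 := by positivity
      calc (k : ℝ) * (π / m) ≤ m * (π / m) := by gcongr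
        _ = π := by field_simp

theorem geomRep_simple_root (cs : CoxeterSystem M W) (i j : B) :
    geomRep cs (cs.simple i) (root j) = root j + (2 * cos (π / M i j)) • root i := by
  rw [geomRep_simple, coroot_root]
  module

theorem geomRep_simple_root_self (cs : CoxeterSystem M W) (i : B) :
    geomRep cs (cs.simple i) (root i) = -root i := by
  rw [geomRep_simple, coroot_root_self]
  module

theorem geomRep_mul_apply (cs : CoxeterSystem M W) (x y : W) (v : B → ℝ) :
    geomRep cs (x * y) v = geomRep cs x (geomRep cs y v) := by
  rw [map_mul, Module.End.mul_apply]

omit [Fintype B] in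
theorem root_nonneg (i : B) : 0 ≤ root i := by
  intro j
  by_cases h : j = i
  · subst h; simp [root]
  · simp [root, h]

/-- The word ends in j, so s_j acts first. Each further letter changes one of the two coordinates,
and the change is exactly one step of the recursion; the parity of k tells which coordinate is the
newer one. -/
theorem geomRep_alternatingWord_root (cs : CoxeterSystem M W) (i j : B) {U : ℕ → ℝ}
    (h0 : U 0 = 0) (h1 : U 1 = 1)
    (hU : ∀ k, U (k + 2) = 2 * cos (π / M i j) * U (k + 1) - U k) (k : ℕ) :
    geomRep cs (cs.wordProd (CoxeterSystem.alternatingWord i j k)) (root i) =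
      if Even k then U (k + 1) • root i + U k • root j
      else U k • root i + U (k + 1) • root j := by
  induction k with
  | zero => simp [CoxeterSystem.alternatingWord, h0, h1]
  | succ k ih =>
    rw [CoxeterSystem.alternatingWord_succ', cs.wordProd_cons, geomRep_mul_apply, ih, hU k]
    by_cases hk : Even k
    · have hk' : ¬ Even (k + 1) := by simpa [Nat.even_add_one] using hk
      simp only [if_pos hk, if_neg hk', map_add, map_smul, geomRep_simple_root_self,
        geomRep_simple_root, M.symmetric j i]
      module
    · have hk' : Even (k + 1) := by simpa [Nat.even_add_one] using hk
      simp only [if_neg hk, if_pos hk', map_add, map_smul, geomRep_simple_root_self,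
        geomRep_simple_root]
      module

-- Additivity of lengths makes the alternating word reduced, hence of length at most m. At length m
-- the braid relation rewrites it as a word ending in i, which would make i a right descent of w.
omit [Fintype B] [DecidableEq B] in
theorem not_isRightDescent_of_eq_mul_alternatingWord (cs : CoxeterSystem M W) {w v : W} {i j : B}
    (hi : ¬ cs.IsRightDescent w i) {k : ℕ}
    (hw : w = v * cs.wordProd (CoxeterSystem.alternatingWord i j k))
    (hl : cs.length v + k = cs.length w) (hm : M i j ≠ 0) : k + 1 ≤ M i j := by
  have hred : cs.IsReduced (CoxeterSystem.alternatingWord i j k) := by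
    have h1 := cs.length_mul_le v (cs.wordProd (CoxeterSystem.alternatingWord i j k))
    have h2 := cs.length_wordProd_le (CoxeterSystem.alternatingWord i j k)
    rw [← hw] at h1
    rw [CoxeterSystem.length_alternatingWord] at h2
    rw [CoxeterSystem.IsReduced, CoxeterSystem.length_alternatingWord]
    omega
  have hle : k ≤ M i j := by
    by_contra h
    exact cs.not_isReduced_alternatingWord i j hm (by omega) hred
  rcases hle.lt_or_eq with h | h
  · exact h
  · exfalso
    apply hi
    have hb := cs.wordProd_braidWord_eq i j
    rw [CoxeterSystem.braidWord, CoxeterSystem.braidWord, M.symmetric j i, ← h] at hb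
    obtain ⟨n, rfl⟩ : ∃ n, k = n + 1 := ⟨k - 1, by omega⟩
    rw [hb, CoxeterSystem.alternatingWord_succ j i, cs.wordProd_concat, ← mul_assoc] at hw
    have h3 : w * cs.simple i = v * cs.wordProd (CoxeterSystem.alternatingWord i j n) := by
      rw [hw, cs.simple_mul_simple_cancel_right]
    have h1 := cs.length_mul_le v (cs.wordProd (CoxeterSystem.alternatingWord i j n))
    have h2 := cs.length_wordProd_le (CoxeterSystem.alternatingWord i j n)
    rw [CoxeterSystem.length_alternatingWord] at h2
    rw [CoxeterSystem.IsRightDescent, h3]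
    omega

/-- Induction on length inside rank two: with j a right descent of w, strip from the right of w the
longest alternating word in i, j ending in j, with lengths adding. The remaining factor v has
neither i nor j as a descent, so it keeps both roots nonnegative, while the stripped word sends α_i
to a nonnegative combination of α_i and α_j. -/
theorem geomRep_root_nonneg (cs : CoxeterSystem M W) (w : W) (i : B)
    (hi : ¬ cs.IsRightDescent w i) : 0 ≤ geomRep cs w (root i) := by
  classical
  induction hn : cs.length w using Nat.strong_induction_on generalizing w i with
  | _ n ih =>
  by_cases hw1 : w = 1
  · subst hw1; simpa using root_nonneg i
  obtain ⟨j, hj⟩ := cs.exists_rightDescent_of_ne_one hw1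
  have hij : i ≠ j := by rintro rfl; exact hi hj
  let a : ℕ → W := fun k => cs.wordProd (CoxeterSystem.alternatingWord i j k)
  have ha : ∀ k, a (k + 1) = cs.simple (if Even k then j else i) * a k := fun k => by
    simp only [a]; rw [CoxeterSystem.alternatingWord_succ', cs.wordProd_cons]
  have ha0 : a 0 = 1 := by simp [a, CoxeterSystem.alternatingWord]
  have hlen : ∀ k, cs.length (a k) ≤ k := fun k =>
    (cs.length_wordProd_le _).trans (CoxeterSystem.length_alternatingWord i j k).le
  let P : ℕ → Prop := fun k => cs.length (w * (a k)⁻¹) + k = cs.length w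
  have hP1 : P 1 := by
    have := cs.isRightDescent_iff.1 hj
    simpa [P, ha, ha0] using this
  have hPle : ∀ k, P k → k ≤ cs.length w := fun k hk => by simp only [P] at hk; omega
  obtain ⟨k, hk1, hPk, hmax⟩ : ∃ k, 1 ≤ k ∧ P k ∧ ¬ P (k + 1) := by
    refine ⟨Nat.findGreatest P (cs.length w), Nat.le_findGreatest (hPle 1 hP1) hP1,
      Nat.findGreatest_spec (hPle 1 hP1) hP1, fun h => ?_⟩
    have := Nat.le_findGreatest (hPle _ h) h
    omega
  obtain ⟨k', rfl⟩ : ∃ k', k = k' + 1 := ⟨k - 1, by omega⟩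
  set v := w * (a (k' + 1))⁻¹ with hv
  have hPv : cs.length v + (k' + 1) = cs.length w := hPk
  have hx : ¬ cs.IsRightDescent v (if Even (k' + 1) then j else i) := by
    rw [cs.isRightDescent_iff]
    intro h
    apply hmax
    have : w * (a (k' + 1 + 1))⁻¹ = v * cs.simple (if Even (k' + 1) then j else i) := by
      rw [ha (k' + 1), mul_inv_rev, cs.inv_simple, ← mul_assoc]
    simp only [P]
    rw [this]
    omega
  -- Multiplying v by this letter restores the last letter stripped, and w times the inverse of a
  -- word of length k' has length at least ℓ(w) - k' > ℓ(v). The other letter is excluded by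
  -- maximality of the stripped word.
  have hy : ¬ cs.IsRightDescent v (if Even k' then j else i) := by
    have h1 : v * cs.simple (if Even k' then j else i) = w * (a k')⁻¹ := by
      rw [hv, ha k', mul_inv_rev, cs.inv_simple, ← mul_assoc, cs.simple_mul_simple_cancel_right]
    have h2 := cs.length_mul_le (w * (a k')⁻¹) (a k')
    rw [inv_mul_cancel_right] at h2
    have h3 := hlen k'
    rw [CoxeterSystem.IsRightDescent, h1]
    omega
  have hvi : ¬ cs.IsRightDescent v i ∧ ¬ cs.IsRightDescent v j := by
    by_cases he : Even k'
    · have he' : ¬ Even (k' + 1) := by simpa [Nat.even_add_one] using he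
      rw [if_neg he'] at hx
      rw [if_pos he] at hy
      exact ⟨hx, hy⟩
    · have he' : Even (k' + 1) := by simpa [Nat.even_add_one] using he
      rw [if_pos he'] at hx
      rw [if_neg he] at hy
      exact ⟨hy, hx⟩
  have pi := ih (cs.length v) (by omega) v i hvi.1 rfl
  have pj := ih (cs.length v) (by omega) v j hvi.2 rfl
  have hwv : w = v * a (k' + 1) := by rw [hv, inv_mul_cancel_right]
  have hkm := not_isRightDescent_of_eq_mul_alternatingWord cs hi hwv hPv
  obtain ⟨U, h0, h1, hU, hpos⟩ := exists_chebyshev_seq (M i j) (M.off_diagonal i j hij)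
  have p1 : 0 ≤ U (k' + 1) := hpos _ fun h => by have := hkm h; omega
  have p2 : 0 ≤ U (k' + 1 + 1) := hpos _ fun h => hkm h
  rw [hwv, geomRep_mul_apply, geomRep_alternatingWord_root cs i j h0 h1 hU]
  split_ifs
  · rw [map_add, map_smul, map_smul]
    exact add_nonneg (smul_nonneg p2 pi) (smul_nonneg p1 pj)
  · rw [map_add, map_smul, map_smul]
    exact add_nonneg (smul_nonneg p1 pi) (smul_nonneg p2 pj)

theorem geomRep_root_nonpos (cs : CoxeterSystem M W) (w : W) (i : B)
    (hi : cs.IsRightDescent w i) : geomRep cs w (root i) ≤ 0 := by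
  have h := geomRep_root_nonneg cs (w * cs.simple i) i
    (cs.isRightDescent_iff_not_isRightDescent_mul.1 hi)
  rw [geomRep_mul_apply, geomRep_simple_root_self, map_neg] at h
  exact neg_nonneg.1 h

omit [Fintype B] in
theorem root_ne_zero (i : B) : root i ≠ 0 := by
  intro h
  have := congrFun h i
  simp [root] at this

theorem geomRep_ne_zero (cs : CoxeterSystem M W) (w : W) {v : B → ℝ} (hv : v ≠ 0) :
    geomRep cs w v ≠ 0 := by
  intro h
  exact hv (rep_injective (geomRep cs) w (by rw [h, map_zero]))

theorem geomRep_root_nonneg_iff (cs : CoxeterSystem M W) (w : W) (i : B) :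
    0 ≤ geomRep cs w (root i) ↔ ¬ cs.IsRightDescent w i := by
  refine ⟨fun h hd => ?_, geomRep_root_nonneg cs w i⟩
  exact geomRep_ne_zero cs w (root_ne_zero i) (le_antisymm (geomRep_root_nonpos cs w i hd) h)

theorem geomRep_root_nonneg_or_nonpos (cs : CoxeterSystem M W) (w : W) (i : B) :
    0 ≤ geomRep cs w (root i) ∨ geomRep cs w (root i) ≤ 0 := by
  by_cases h : cs.IsRightDescent w i
  · exact Or.inr (geomRep_root_nonpos cs w i h)
  · exact Or.inl (geomRep_root_nonneg cs w i h)

theorem eq_one_of_forall_root_nonneg (cs : CoxeterSystem M W) {w : W}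
    (h : ∀ i, 0 ≤ geomRep cs w (root i)) : w = 1 := by
  by_contra hw
  obtain ⟨i, hi⟩ := cs.exists_rightDescent_of_ne_one hw
  exact (geomRep_root_nonneg_iff cs w i).1 (h i) hi

theorem geomRep_injective (cs : CoxeterSystem M W) : Function.Injective (geomRep cs) := by
  rw [injective_iff_map_eq_one]
  intro w hw
  refine eq_one_of_forall_root_nonneg cs fun i => ?_
  rw [hw]
  exact root_nonneg i

end Positivity

/-! ### The invariant inner product, parabolic subgroups and their normalizers -/

section InvariantForm

variable {B W : Type*} [Fintype B] [DecidableEq B] [Group W] [Finite W] {M : CoxeterMatrix B}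

/-- The inner product on `ℝ^B` obtained from the standard one by averaging over `W`. -/
def invForm (cs : CoxeterSystem M W) : LinearMap.BilinForm ℝ (B → ℝ) :=
  letI := Fintype.ofFinite W
  ∑ g : W, (dotProductBilin ℝ ℝ).compl₁₂ (geomRep cs g) (geomRep cs g)

variable (cs : CoxeterSystem M W)

theorem invForm_apply [Fintype W] (u v : B → ℝ) :
    invForm cs u v = ∑ g : W, geomRep cs g u ⬝ᵥ geomRep cs g v := by
  have : (Fintype.ofFinite W) = ‹Fintype W› := Subsingleton.elim _ _
  simp [invForm, LinearMap.sum_apply]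
  rw [this]

theorem invForm_symm (u v : B → ℝ) : invForm cs u v = invForm cs v u := by
  let := Fintype.ofFinite W
  simp only [invForm_apply, dotProduct_comm]

theorem invForm_self_pos {u : B → ℝ} (hu : u ≠ 0) : 0 < invForm cs u u := by
  let := Fintype.ofFinite W
  rw [invForm_apply]
  refine Finset.sum_pos (fun g _ => ?_) Finset.univ_nonempty
  refine lt_of_le_of_ne (Finset.sum_nonneg fun i _ => mul_self_nonneg _) fun h => ?_
  exact geomRep_ne_zero cs g hu (dotProduct_self_eq_zero.1 h.symm)

theorem invForm_geomRep (w : W) (u v : B → ℝ) :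
    invForm cs (geomRep cs w u) (geomRep cs w v) = invForm cs u v := by
  let := Fintype.ofFinite W
  simp only [invForm_apply, ← geomRep_mul_apply]
  exact Fintype.sum_equiv (Equiv.mulRight w) _ _ fun g => rfl

theorem invForm_geomRep_left (w : W) (u v : B → ℝ) :
    invForm cs (geomRep cs w u) v = invForm cs u (geomRep cs w⁻¹ v) := by
  rw [← invForm_geomRep cs w u, rep_apply_inv]

/-- Invariance under s_i, which negates α_i. This is the only link needed between the averaged form
and the Coxeter matrix. -/
theorem invForm_root_left (i : B) (v : B → ℝ) :
    2 * invForm cs (root i) v = coroot M i v * invForm cs (root i) (root i) := by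
  have h := invForm_geomRep cs (cs.simple i) (root i) v
  rw [geomRep_simple_root_self, geomRep_simple] at h
  simp only [map_neg, map_sub, map_smul, LinearMap.neg_apply, smul_eq_mul] at h
  linarith

theorem invForm_root_pos (i : B) : 0 < invForm cs (root i) (root i) :=
  invForm_self_pos cs (root_ne_zero i)

theorem invForm_root_eq_zero_iff (i : B) (v : B → ℝ) :
    invForm cs (root i) v = 0 ↔ coroot M i v = 0 := by
  have h := invForm_root_left cs i v
  have hp := invForm_root_pos cs i
  constructor
  · intro h0
    rw [h0, mul_zero, eq_comm, mul_eq_zero] at h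
    exact h.resolve_right hp.ne'
  · intro h0
    rw [h0, zero_mul] at h
    linarith

omit [Finite W] [Group W] in
theorem eq_sum_smul_root (v : B → ℝ) : v = ∑ i, v i • root i := by
  ext k
  simp [root, Finset.sum_apply, Pi.single_apply]

theorem invForm_eq_sum (u v : B → ℝ) : invForm cs u v = ∑ i, u i * invForm cs (root i) v := by
  conv_lhs => rw [eq_sum_smul_root u]
  simp [LinearMap.sum_apply]

/-- A conjugate of `s_i` acts as the orthogonal reflection in the corresponding root. -/
theorem geomRep_conj_simple (x : W) (i : B) (v : B → ℝ) :
    geomRep cs (x * cs.simple i * x⁻¹) v =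
      v - (2 * invForm cs (geomRep cs x (root i)) v /
        invForm cs (geomRep cs x (root i)) (geomRep cs x (root i))) • geomRep cs x (root i) := by
  rw [geomRep_mul_apply, geomRep_mul_apply, geomRep_simple, map_sub, map_smul, rep_apply_inv,
    invForm_geomRep, invForm_geomRep_left, invForm_root_left,
    mul_div_cancel_right₀ _ (invForm_root_pos cs i).ne']

theorem mem_fixedSpace_conj_simple (x : W) (i : B) (v : B → ℝ) :
    v ∈ fixedSpace (geomRep cs) (x * cs.simple i * x⁻¹) ↔
      invForm cs (geomRep cs x (root i)) v = 0 := by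
  have h0 := geomRep_ne_zero cs x (root_ne_zero i)
  have hp := invForm_self_pos cs h0
  rw [mem_fixedSpace, geomRep_conj_simple, sub_eq_self, smul_eq_zero, or_iff_left h0,
    div_eq_zero_iff, or_iff_left hp.ne', mul_eq_zero, or_iff_right two_ne_zero]

/-- Both sides act as the orthogonal reflection in the same line, and the representation is
faithful. -/
theorem conj_simple_eq_of_geomRep_root_eq {x : W} {i j : B} {c : ℝ}
    (h : geomRep cs x (root i) = c • root j) : x * cs.simple i * x⁻¹ = cs.simple j := by
  have hc : c ≠ 0 := by
    rintro rfl
    exact geomRep_ne_zero cs x (root_ne_zero i) (by rw [h, zero_smul])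
  apply geomRep_injective cs
  refine LinearMap.ext fun v => ?_
  have hj := geomRep_conj_simple cs 1 j v
  simp only [one_mul, inv_one, mul_one, map_one, Module.End.one_apply] at hj
  rw [geomRep_conj_simple, h, hj, smul_smul]
  congr 2
  have := (invForm_root_pos cs j).ne'
  simp only [map_smul, LinearMap.smul_apply, smul_eq_mul]
  field_simp

omit [Fintype B] [DecidableEq B] [Finite W] in
theorem exists_refl_conj_eq (t : Refl cs.simple) :
    ∃ (x : W) (i : B), t.1 = x * cs.simple i * x⁻¹ := by
  obtain ⟨i, g, h⟩ := t.2
  exact ⟨g⁻¹, i, by rw [h, inv_inv]⟩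

/-! ### The decomposition of `V` with respect to a parabolic subgroup -/

variable (L : Finset B)

theorem mem_fixedBy_parabolic {v : B → ℝ} :
    v ∈ fixedBy (geomRep cs) (parabolic cs L) ↔ ∀ i ∈ L, invForm cs (root i) v = 0 := by
  rw [mem_fixedBy]
  have hs : ∀ i, geomRep cs (cs.simple i) v = v ↔ invForm cs (root i) v = 0 := fun i => by
    rw [geomRep_simple, sub_eq_self, smul_eq_zero, or_iff_left (root_ne_zero i),
      invForm_root_eq_zero_iff]
  constructor
  · intro h i hi
    exact (hs i).1 (h _ (Subgroup.subset_closure ⟨i, hi, rfl⟩))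
  · intro h w hw
    induction hw using Subgroup.closure_induction with
    | one => simp
    | mem x hx => obtain ⟨i, hi, rfl⟩ := hx; exact (hs i).2 (h i hi)
    | inv x _ hx => conv_lhs => rw [← hx, rep_inv_apply]
    | mul x y _ _ hx hy => rw [geomRep_mul_apply, hy, hx]

omit [Fintype B] [Group W] [Finite W] in
theorem root_mem_parabolicSpace {L : Finset B} {i : B} (hi : i ∈ L) :
    root i ∈ parabolicSpace L := Submodule.subset_span ⟨i, hi, rfl⟩

theorem fixedBy_parabolic_eq_orthogonal :
    fixedBy (geomRep cs) (parabolic cs L) = (invForm cs).orthogonal (parabolicSpace L) := by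
  ext v
  rw [mem_fixedBy_parabolic, LinearMap.BilinForm.mem_orthogonal_iff]
  constructor
  · intro h u hu
    change invForm cs u v = 0
    induction hu using Submodule.span_induction with
    | mem x hx => obtain ⟨i, hi, rfl⟩ := hx; exact h i hi
    | zero => simp
    | add x y _ _ hx hy => simp [hx, hy]
    | smul a x _ hx => simp [hx]
  · intro h i hi
    exact h _ (root_mem_parabolicSpace hi)

theorem isCompl_parabolicSpace_fixedBy :
    IsCompl (parabolicSpace L) (fixedBy (geomRep cs) (parabolic cs L)) := by
  rw [fixedBy_parabolic_eq_orthogonal]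
  have hr : (invForm cs).IsRefl := fun u v h => by rw [invForm_symm, h]
  refine (LinearMap.BilinForm.isCompl_orthogonal_iff_disjoint hr).2 ?_
  rw [Submodule.disjoint_def]
  intro v hv hv'
  by_contra h0
  exact (invForm_self_pos cs h0).ne' (LinearMap.BilinForm.mem_orthogonal_iff.1 hv' v hv)

theorem mem_parabolicSpace_of_forall_fixedBy {v : B → ℝ}
    (h : ∀ y ∈ fixedBy (geomRep cs) (parabolic cs L), invForm cs v y = 0) :
    v ∈ parabolicSpace L := by
  have hv : v ∈ parabolicSpace L ⊔ fixedBy (geomRep cs) (parabolic cs L) := by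
    rw [(isCompl_parabolicSpace_fixedBy cs L).sup_eq_top]; trivial
  obtain ⟨a, ha, y, hy, rfl⟩ := Submodule.mem_sup.1 hv
  have h1 := h y hy
  rw [fixedBy_parabolic_eq_orthogonal, LinearMap.BilinForm.mem_orthogonal_iff] at hy
  rw [map_add, LinearMap.add_apply, hy a ha, zero_add] at h1
  have : y = 0 := by
    by_contra h0
    exact (invForm_self_pos cs h0).ne' h1
  rwa [this, add_zero]

theorem invForm_eq_zero_of_mem {v y : B → ℝ} (hv : v ∈ parabolicSpace L)
    (hy : y ∈ fixedBy (geomRep cs) (parabolic cs L)) : invForm cs v y = 0 := by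
  rw [fixedBy_parabolic_eq_orthogonal, LinearMap.BilinForm.mem_orthogonal_iff] at hy
  exact hy v hv

omit [Fintype B] [Group W] [Finite W] in
theorem apply_eq_zero_of_mem_parabolicSpace {L : Finset B} {v : B → ℝ} (hv : v ∈ parabolicSpace L)
    {i : B} (hi : i ∉ L) : v i = 0 := by
  induction hv using Submodule.span_induction with
  | mem x hx =>
    obtain ⟨j, hj, rfl⟩ := hx
    have : i ≠ j := by rintro rfl; exact hi hj
    simp [root, this]
  | zero => rfl
  | add x y _ _ hx hy => simp [hx, hy]
  | smul a x _ hx => simp [hx]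

/-- A vector killed by all coroots is orthogonal to every simple root, hence to itself. So the
coroots are coordinates on V. -/
theorem exists_coroot_eq (cs : CoxeterSystem M W) (f : B → ℝ) : ∃ v : B → ℝ, ∀ i, coroot M i v = f i := by
  have hinj : Function.Injective (LinearMap.pi (coroot M)) := by
    rw [injective_iff_map_eq_zero]
    intro v hv
    have h0 : ∀ i, invForm cs (root i) v = 0 := fun i =>
      (invForm_root_eq_zero_iff cs i v).2 (congrFun hv i)
    by_contra hne
    have := invForm_self_pos cs hne
    rw [invForm_eq_sum] at this
    simp [h0] at this
  obtain ⟨v, hv⟩ := LinearMap.surjective_of_injective hinj f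
  exact ⟨v, fun i => congrFun hv i⟩

/-- An element that fixes `Fix(W_L)` pointwise lies in `W_L`. -/
theorem mem_parabolic_of_fixedBy_le {w : W}
    (hw : fixedBy (geomRep cs) (parabolic cs L) ≤ fixedSpace (geomRep cs) w) :
    w ∈ parabolic cs L := by
  -- A dominant vector on exactly the walls indexed by L. The induction below shows that its
  -- stabilizer is contained in W_L.
  obtain ⟨v, hv⟩ := exists_coroot_eq cs fun i => if i ∈ L then 0 else 1
  have hpos : ∀ i, 0 ≤ invForm cs (root i) v := fun i => by
    have h1 := invForm_root_left cs i v
    have h2 : 0 ≤ coroot M i v := by rw [hv]; split_ifs <;> norm_num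
    have := mul_nonneg h2 (invForm_root_pos cs i).le
    linarith
  have hvY : v ∈ fixedBy (geomRep cs) (parabolic cs L) := by
    rw [mem_fixedBy_parabolic]
    intro i hi
    rw [invForm_root_eq_zero_iff, hv, if_pos hi]
  have key : ∀ n w, cs.length w = n → geomRep cs w v = v → w ∈ parabolic cs L := by
    intro n
    induction n with
    | zero => intro w hw _; rw [cs.length_eq_zero_iff.1 hw]; exact one_mem _
    | succ n ih =>
      intro w hl hwv
      have hne : w ≠ 1 := by rintro rfl; simp at hl
      obtain ⟨i, hi⟩ := cs.exists_rightDescent_of_ne_one hne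
      -- If w fixes v, then ⟨α_i, v⟩ = ⟨w α_i, v⟩ ≤ 0 at a right descent i. Dominance makes this
      -- zero, so i ∈ L and s_i can be cancelled from w.
      have hneg := geomRep_root_nonpos cs w i hi
      have h1 : invForm cs (root i) v ≤ 0 := by
        rw [← invForm_geomRep cs w, hwv, invForm_eq_sum]
        exact Finset.sum_nonpos fun k _ => mul_nonpos_of_nonpos_of_nonneg (hneg k) (hpos k)
      have h2 : coroot M i v = 0 :=
        (invForm_root_eq_zero_iff cs i v).1 (le_antisymm h1 (hpos i))
      have hiL : i ∈ L := by
        by_contra h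
        rw [hv, if_neg h] at h2
        exact one_ne_zero h2
      have hsv : geomRep cs (cs.simple i) v = v := by
        rw [geomRep_simple, h2, zero_smul, sub_zero]
      have h3 := ih (w * cs.simple i) (by have := cs.isRightDescent_iff.1 hi; omega)
        (by rw [geomRep_mul_apply, hsv, hwv])
      have h4 := mul_mem h3 (Subgroup.subset_closure ⟨i, hiL, rfl⟩ :
        cs.simple i ∈ parabolic cs L)
      rwa [cs.simple_mul_simple_cancel_right] at h4
  exact key _ w rfl (mem_fixedSpace.1 (hw hvY))

theorem geomRep_mem_parabolicSpace_of_mem_normalizer {n : W} (hn : n ∈ parabolicNormalizer cs L)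
    {v : B → ℝ} (hv : v ∈ parabolicSpace L) : geomRep cs n v ∈ parabolicSpace L := by
  refine mem_parabolicSpace_of_forall_fixedBy cs L fun y hy => ?_
  rw [invForm_geomRep_left]
  exact invForm_eq_zero_of_mem cs L hv
    (rep_mem_fixedBy (geomRep cs) (parabolic cs L) (⟨n, hn⟩⁻¹ : parabolicNormalizer cs L) y hy)

/-- A reflection that fixes `Fix(W_L)` pointwise is conjugate in `W_L` to an element of `L`. -/
theorem exists_parabolic_conj_of_fixedBy_le (t : Refl cs.simple)
    (ht : fixedBy (geomRep cs) (parabolic cs L) ≤ fixedSpace (geomRep cs) t.1) :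
    ∃ i ∈ L, ∃ g ∈ parabolic cs L, t.1 = g⁻¹ * cs.simple i * g := by
  obtain ⟨x, j, hx, hpos⟩ :
      ∃ x j, t.1 = x * cs.simple j * x⁻¹ ∧ 0 ≤ geomRep cs x (root j) := by
    obtain ⟨x, j, hx⟩ := exists_refl_conj_eq cs t
    rcases geomRep_root_nonneg_or_nonpos cs x j with h | h
    · exact ⟨x, j, hx, h⟩
    · refine ⟨x * cs.simple j, j, ?_, ?_⟩
      · rw [hx]; simp [mul_assoc]
      · rw [geomRep_mul_apply, geomRep_simple_root_self, map_neg]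
        exact neg_nonneg.2 h
  have hβ : geomRep cs x (root j) ∈ parabolicSpace L :=
    mem_parabolicSpace_of_forall_fixedBy cs L fun y hy =>
      (mem_fixedSpace_conj_simple cs x j y).1 (hx ▸ ht hy)
  -- Among the nonnegative W_L-translates of the root of t, take one of least height. Some i in its
  -- support has ⟨α_i, β⟩ > 0, so s_i lowers the height and must make β nonpositive. But s_i changes
  -- only the i-th coordinate, so β is a multiple of α_i.
  obtain ⟨g, ⟨hg, hg0⟩, hmin⟩ := Set.exists_min_image
    {g : W | g ∈ parabolic cs L ∧ 0 ≤ geomRep cs (g * x) (root j)}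
    (fun g => ∑ k, geomRep cs (g * x) (root j) k) (Set.toFinite _)
    ⟨1, one_mem _, by rwa [one_mul]⟩
  set β := geomRep cs (g * x) (root j) with hβdef
  have hβL : β ∈ parabolicSpace L := by
    rw [hβdef, geomRep_mul_apply]
    exact geomRep_mem_parabolicSpace cs L ⟨g, hg⟩ _ hβ
  have hβp : 0 < invForm cs β β :=
    invForm_self_pos cs (geomRep_ne_zero cs _ (root_ne_zero j))
  rw [invForm_eq_sum] at hβp
  obtain ⟨i, -, hi⟩ := Finset.exists_lt_of_sum_lt (s := Finset.univ) (f := fun _ : B => (0 : ℝ))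
    (by simpa using hβp)
  have hi1 : 0 < β i := lt_of_le_of_ne (hg0 i) fun h => by rw [← h, zero_mul] at hi; exact hi.false
  have hi2 : 0 < invForm cs (root i) β := (mul_pos_iff_of_pos_left hi1).1 hi
  have hiL : i ∈ L := by
    by_contra h
    exact hi1.ne' (apply_eq_zero_of_mem_parabolicSpace hβL h)
  have hc : 0 < coroot M i β := by
    have h1 := invForm_root_left cs i β
    have h2 := invForm_root_pos cs i
    exact (mul_pos_iff_of_pos_right h2).1 (by linarith)
  have hsβ : geomRep cs (cs.simple i * g * x) (root j) = β - coroot M i β • root i := by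
    rw [mul_assoc, geomRep_mul_apply, geomRep_simple]
  have hneg : geomRep cs (cs.simple i * g * x) (root j) ≤ 0 := by
    refine (geomRep_root_nonneg_or_nonpos cs _ j).resolve_left fun h => ?_
    have := hmin (cs.simple i * g)
      ⟨mul_mem (Subgroup.subset_closure ⟨i, hiL, rfl⟩) hg, h⟩
    rw [hsβ] at this
    simp [root, Finset.sum_sub_distrib, Pi.single_apply] at this
    linarith
  have heq : β = β i • root i := by
    ext k
    by_cases hk : k = i
    · subst hk; simp [root]
    · have h1 := hneg k
      rw [hsβ] at h1
      have h2 := hg0 k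
      simp [root, hk] at h1 h2 ⊢
      linarith
  have h := conj_simple_eq_of_geomRep_root_eq cs (hβdef.symm.trans heq)
  refine ⟨i, hiL, g, hg, ?_⟩
  rw [hx, ← h]
  group

/-! ### Minimal coset representatives -/

omit [Finite W] [Fintype B] [DecidableEq B] in
theorem wordLength_simple (g : W) : wordLength cs.simple g = cs.length g := by
  refine le_antisymm ?_ ?_
  · obtain ⟨ω, h1, h2⟩ := cs.exists_isReduced g
    exact Nat.sInf_le ⟨ω, by rw [h2, h1.eq], h2.symm⟩
  · obtain ⟨ω, h1, h2⟩ := cs.exists_isReduced g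
    obtain ⟨ω', h1', h2'⟩ := Nat.sInf_mem
      (s := {n | ∃ ω : List B, ω.length = n ∧ (ω.map cs.simple).prod = g}) ⟨_, ω, rfl, h2.symm⟩
    rw [wordLength, ← h1', ← h2']
    exact cs.length_wordProd_le ω'

omit [Finite W] in
theorem mem_X_iff {x : W} : x ∈ X cs.simple L ↔ ∀ i ∈ L, 0 ≤ geomRep cs x⁻¹ (root i) := by
  refine forall₂_congr fun i _ => ?_
  rw [wordLength_simple, wordLength_simple, geomRep_root_nonneg_iff, cs.isRightDescent_inv_iff,
    CoxeterSystem.IsLeftDescent, not_lt]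
  exact ⟨le_of_lt, fun h => lt_of_le_of_ne h (cs.length_simple_mul_ne x i).symm⟩

omit [Finite W] in
theorem geomRep_apply_of_notMem {w : W} (hw : w ∈ parabolic cs L) (v : B → ℝ) {k : B}
    (hk : k ∉ L) : geomRep cs w v k = v k := by
  induction hw using Subgroup.closure_induction'' generalizing v with
  | one => simp
  | mem x hx =>
    obtain ⟨i, hi, rfl⟩ := hx
    have : k ≠ i := by rintro rfl; exact hk hi
    simp [geomRep_simple, root, this]
  | inv_mem x hx =>
    obtain ⟨i, hi, rfl⟩ := hx
    have : k ≠ i := by rintro rfl; exact hk hi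
    simp [geomRep_simple, root, this]
  | mul x y _ _ hx hy => rw [geomRep_mul_apply, hx, hy]

-- The inverse of x keeps α_i nonnegative for i ∈ L by minimality. For i ∉ L it does so because W_L
-- leaves the i-th coordinate equal to 1.
omit [Finite W] in
theorem eq_one_of_mem_X {x : W} (hx : x ∈ X cs.simple L) (hL : x ∈ parabolic cs L) : x = 1 := by
  rw [mem_X_iff] at hx
  rw [← inv_eq_one]
  refine eq_one_of_forall_root_nonneg cs fun i => ?_
  by_cases hi : i ∈ L
  · exact hx i hi
  · refine (geomRep_root_nonneg_or_nonpos cs x⁻¹ i).resolve_right fun h => ?_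
    have := h i
    rw [geomRep_apply_of_notMem cs L (inv_mem hL) _ hi] at this
    simp [root] at this
    linarith

omit [Finite W] in
theorem one_mem_X : (1 : W) ∈ X cs.simple L := by
  rw [mem_X_iff]
  intro i _
  simpa using root_nonneg i

/-- An element of `N_W(W_L)` is a product of an element of `W_L` and an element that permutes
the rays spanned by the simple roots of `W_L`. -/
theorem exists_mul_eq_of_mem_normalizer {g : W} (hg : g ∈ parabolicNormalizer cs L) :
    ∃ u ∈ parabolic cs L, ∃ n ∈ parabolicNormalizer cs L, g = u * n ∧
      ∀ i ∈ L, ∃ r ∈ L, ∃ c : ℝ, 0 < c ∧ geomRep cs n (root i) = c • root r := by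
  -- The factor n is a shortest element of W_L g. Since n normalizes W_L, it is also shortest in n
  -- W_L, so both n and its inverse send the simple roots of L to nonnegative vectors.
  obtain ⟨u, hu, hmin⟩ := Set.exists_min_image {u : W | u ∈ parabolic cs L}
    (fun u => cs.length (u * g)) (Set.toFinite _) ⟨1, one_mem (parabolic cs L)⟩
  set n := u * g with hn
  have hle : parabolic cs L ≤ parabolicNormalizer cs L := Subgroup.le_normalizer
  have hnN : n ∈ parabolicNormalizer cs L := mul_mem (hle hu) hg
  have hs : ∀ i ∈ L, cs.simple i ∈ parabolic cs L := fun i hi =>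
    Subgroup.subset_closure ⟨i, hi, rfl⟩
  have hmin' : ∀ v ∈ parabolic cs L, cs.length n ≤ cs.length (v * n) := fun v hv => by
    have := hmin (v * u) (mul_mem hv hu)
    rwa [mul_assoc] at this
  have hpos : ∀ i ∈ L, 0 ≤ geomRep cs n (root i) := fun i hi => by
    refine geomRep_root_nonneg cs n i fun hd => ?_
    have := hmin' _ ((Subgroup.mem_normalizer_iff.1 hnN _).1 (hs i hi))
    rw [inv_mul_cancel_right] at this
    exact absurd hd (not_lt.2 this)
  have hposi : ∀ i ∈ L, 0 ≤ geomRep cs n⁻¹ (root i) := fun i hi => by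
    refine geomRep_root_nonneg cs n⁻¹ i fun hd => ?_
    rw [cs.isRightDescent_inv_iff] at hd
    exact absurd hd (not_lt.2 (hmin' _ (hs i hi)))
  refine ⟨u⁻¹, inv_mem hu, n, hnN, by rw [hn, inv_mul_cancel_left], fun i hi => ?_⟩
  have hmem := geomRep_mem_parabolicSpace_of_mem_normalizer cs L hnN
    (root_mem_parabolicSpace hi)
  have hne := geomRep_ne_zero cs n (root_ne_zero i)
  obtain ⟨r, hr⟩ : ∃ r, geomRep cs n (root i) r ≠ 0 := Function.ne_iff.1 hne
  have hrL : r ∈ L := by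
    by_contra h
    exact hr (apply_eq_zero_of_mem_parabolicSpace hmem h)
  -- Two mutually inverse nonnegative matrices are monomial: expanding α_i = n⁻¹(n α_i) gives a sum
  -- of nonnegative vectors supported at i alone, so each term with nonzero coefficient is supported
  -- there.
  have hexp : root i = ∑ k, geomRep cs n (root i) k • geomRep cs n⁻¹ (root k) := by
    conv_lhs => rw [← rep_inv_apply (geomRep cs) n (root i),
      eq_sum_smul_root (geomRep cs n (root i))]
    simp
  have hnn : ∀ k l, 0 ≤ geomRep cs n (root i) k * geomRep cs n⁻¹ (root k) l := fun k l => by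
    by_cases hk : k ∈ L
    · exact mul_nonneg (hpos i hi k) (hposi k hk l)
    · rw [apply_eq_zero_of_mem_parabolicSpace hmem hk, zero_mul]
  have heq : geomRep cs n⁻¹ (root r) = geomRep cs n⁻¹ (root r) i • root i := by
    ext l
    by_cases hl : l = i
    · subst hl; simp [root]
    · have h1 := congrFun hexp l
      simp only [root, Finset.sum_apply, Pi.smul_apply, smul_eq_mul, Pi.single_eq_of_ne hl] at h1
      have h2 := (Finset.sum_eq_zero_iff_of_nonneg fun k _ => hnn k l).1 h1.symm r
        (Finset.mem_univ r)
      have h3 := (mul_eq_zero.1 h2).resolve_left hr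
      simp [root, hl] at h3 ⊢
      exact h3
  have hd : 0 < geomRep cs n⁻¹ (root r) i := by
    refine lt_of_le_of_ne (hposi r hrL i) fun h => ?_
    rw [← h, zero_smul] at heq
    exact geomRep_ne_zero cs n⁻¹ (root_ne_zero r) heq
  refine ⟨r, hrL, (geomRep cs n⁻¹ (root r) i)⁻¹, inv_pos.2 hd, ?_⟩
  have h := congrArg (geomRep cs n) heq
  rw [rep_apply_inv, map_smul] at h
  exact (eq_inv_smul_iff₀ hd.ne').2 h.symm

end InvariantForm

/-! ### Consequences of the Orlik–Solomon relations -/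

section OrlikSolomon

variable {G B V : Type*} [Group G] [AddCommGroup V] [Module ℝ V]
variable (s : B → G) (ρ : Representation ℝ G V)

@[simp]
theorem flat_nil : flat s ρ [] = ⊤ := by simp [flat]

@[simp]
theorem flat_cons (t : Refl s) (l : List (Refl s)) :
    flat s ρ (t :: l) = fixedSpace ρ t.1 ⊓ flat s ρ l := by
  simp [flat, iInf_or, iInf_inf_eq]

theorem le_flat_iff (Y : Submodule ℝ V) (l : List (Refl s)) :
    Y ≤ flat s ρ l ↔ ∀ t ∈ l, Y ≤ fixedSpace ρ t.1 := by
  simp [flat]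

theorem osMonomial_cons (t : Refl s) (l : List (Refl s)) :
    osMonomial s ρ (t :: l) = osMonomial s ρ [t] * osMonomial s ρ l := by
  simp [osMonomial, monomial]

theorem osMonomial_mul_self (t : Refl s) : osMonomial s ρ [t] * osMonomial s ρ [t] = 0 := by
  have h := RingQuot.mkAlgHom_rel ℂ (OSRel.anticomm (ρ := ρ) t t)
  rw [map_neg] at h
  change osMonomial s ρ [t, t] = -osMonomial s ρ [t, t] at h
  rw [← osMonomial_cons]
  have h2 : (2 : ℂ) • osMonomial s ρ [t, t] = 0 := by
    rw [two_smul]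
    nth_rw 2 [h]
    exact add_neg_cancel _
  simpa [smul_smul] using congrArg ((2 : ℂ)⁻¹ • ·) h2

/-- The boundary relation of t :: l, solved for the term in which t is deleted. It rewrites a
monomial so that every term starts with a chosen a_t. -/
theorem osMonomial_eq_sum_of_isDependent {t : Refl s} {l : List (Refl s)}
    (h : IsDependent s ρ (t :: l)) :
    osMonomial s ρ l = ∑ i ∈ Finset.range l.length,
      (-1 : ℂ) ^ i • (osMonomial s ρ [t] * osMonomial s ρ (l.eraseIdx i)) := by
  have h1 := RingQuot.mkAlgHom_rel ℂ (OSRel.dependent (t :: l) h)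
  rw [boundary, List.length_cons, Finset.sum_range_succ', map_zero, map_add, map_sum] at h1
  simp only [map_smul, List.eraseIdx_cons_succ, List.eraseIdx_cons_zero] at h1
  change ∑ i ∈ Finset.range l.length, (-1 : ℂ) ^ (i + 1 + 1) •
    osMonomial s ρ (t :: l.eraseIdx i) + (-1 : ℂ) ^ (0 + 1) • osMonomial s ρ l = 0 at h1
  have h2 : ∀ i, osMonomial s ρ (t :: l.eraseIdx i) =
      osMonomial s ρ [t] * osMonomial s ρ (l.eraseIdx i) := fun i => osMonomial_cons s ρ t _
  simp only [h2] at h1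
  have h3 : (-1 : ℂ) ^ (0 + 1) • osMonomial s ρ l = -osMonomial s ρ l := by
    rw [zero_add, pow_one, Algebra.smul_def, map_neg, map_one]
    exact neg_one_mul (osMonomial s ρ l)
  rw [h3, add_neg_eq_zero] at h1
  rw [← h1]
  refine Finset.sum_congr rfl fun i _ => ?_
  congr 1
  ring

/-- Multiply the previous expansion by a_t and use a_t² = 0. The empty list is never dependent. -/
theorem osMonomial_eq_zero_of_isDependent {l : List (Refl s)} (h : IsDependent s ρ l) :
    osMonomial s ρ l = 0 := by
  cases l with
  | nil =>
    rw [IsDependent, flat_nil, finrank_top, List.length_nil] at h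
    omega
  | cons t l =>
    rw [osMonomial_cons, osMonomial_eq_sum_of_isDependent s ρ h, Finset.mul_sum]
    refine Finset.sum_eq_zero fun i _ => ?_
    rw [mul_smul_comm, ← mul_assoc, osMonomial_mul_self, zero_mul, smul_zero]

end OrlikSolomon

/-! ### Bounding dim A_Y by the number of elements with fixed space Y -/

section DimensionBound

variable {B W : Type*} [Fintype B] [DecidableEq B] [Group W] [Finite W] {M : CoxeterMatrix B}
variable (cs : CoxeterSystem M W)

theorem finrank_le_finrank_fixedSpace_inf_add_one (t : Refl cs.simple)
    (X : Submodule ℝ (B → ℝ)) :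
    Module.finrank ℝ X ≤ Module.finrank ℝ ↥(fixedSpace (geomRep cs) t.1 ⊓ X) + 1 := by
  obtain ⟨x, i, ht⟩ := exists_refl_conj_eq cs t
  have hker : fixedSpace (geomRep cs) t.1 =
      LinearMap.ker (invForm cs (geomRep cs x (root i))) := by
    ext v
    rw [ht, mem_fixedSpace_conj_simple, LinearMap.mem_ker]
  have h1 := (invForm cs (geomRep cs x (root i))).finrank_range_add_finrank_ker
  have h2 : Module.finrank ℝ
      (LinearMap.range (invForm cs (geomRep cs x (root i)))) ≤ 1 := by
    simpa using Submodule.finrank_le (LinearMap.range (invForm cs (geomRep cs x (root i))))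
  have h3 := Submodule.finrank_sup_add_finrank_inf_eq (fixedSpace (geomRep cs) t.1) X
  have h4 := Submodule.finrank_le (fixedSpace (geomRep cs) t.1 ⊔ X)
  rw [← hker] at h1
  omega

theorem finrank_le_finrank_flat_add_length (l : List (Refl cs.simple)) :
    Module.finrank ℝ (B → ℝ) ≤ Module.finrank ℝ (flat cs.simple (geomRep cs) l) + l.length := by
  induction l with
  | nil => rw [flat_nil, finrank_top]; simp
  | cons t l ih =>
    have := finrank_le_finrank_fixedSpace_inf_add_one cs t (flat cs.simple (geomRep cs) l)
    rw [flat_cons, List.length_cons]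
    omega

/-- If the reflecting hyperplane of `t` does not contain `Fix(w)`, then multiplication by `t`
cuts `Fix(w)` down to its intersection with that hyperplane. -/
theorem fixedSpace_mul_refl (t : Refl cs.simple) (w : W)
    (h : ¬ fixedSpace (geomRep cs) w ≤ fixedSpace (geomRep cs) t.1) :
    fixedSpace (geomRep cs) (w * t.1) =
      fixedSpace (geomRep cs) w ⊓ fixedSpace (geomRep cs) t.1 := by
  obtain ⟨x, i, ht⟩ := exists_refl_conj_eq cs t
  obtain ⟨u, hu, hut⟩ := SetLike.not_le_iff_exists.1 h
  rw [ht, mem_fixedSpace_conj_simple] at hut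
  rw [mem_fixedSpace] at hu
  have key : ∀ v, v ∈ fixedSpace (geomRep cs) (w * t.1) →
      v ∈ fixedSpace (geomRep cs) t.1 := by
    intro v hv
    rw [mem_fixedSpace, geomRep_mul_apply] at hv
    -- With u fixed by w and w t v = v, invariance gives ⟨u, v⟩ = ⟨u, t v⟩. As t v - v is a multiple
    -- of the root of t, which is not orthogonal to u, that multiple is zero.
    have h1 := invForm_geomRep cs w u (geomRep cs t.1 v)
    rw [hu, hv, ht, geomRep_conj_simple, map_sub, map_smul, invForm_symm cs u (geomRep cs x _),
      eq_comm, sub_eq_self, smul_eq_zero, or_iff_left hut] at h1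
    rw [mem_fixedSpace, ht, geomRep_conj_simple, h1, zero_smul, sub_zero]
  ext v
  rw [Submodule.mem_inf]
  constructor
  · intro hv
    refine ⟨?_, key v hv⟩
    have h2 := key v hv
    rw [mem_fixedSpace] at h2
    rw [mem_fixedSpace, geomRep_mul_apply, h2] at hv
    exact mem_fixedSpace.2 hv
  · rintro ⟨h1, h2⟩
    rw [mem_fixedSpace] at h1 h2 ⊢
    rw [geomRep_mul_apply, h2, h1]

theorem finrank_finset_sup_le {K E ι : Type*} [Field K] [AddCommGroup E] [Module K E]
    (F : Finset ι) (U : ι → Submodule K E) (hU : ∀ i ∈ F, Module.Finite K (U i)) :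
    Module.Finite K ↥(F.sup U) ∧
      Module.finrank K ↥(F.sup U) ≤ ∑ i ∈ F, Module.finrank K (U i) := by
  classical
  induction F using Finset.induction_on with
  | empty =>
    rw [Finset.sup_empty]
    exact ⟨inferInstance, by simp⟩
  | insert a F ha ih =>
    obtain ⟨h1, h2⟩ := ih fun i hi => hU i (Finset.mem_insert_of_mem hi)
    have h3 := hU a (Finset.mem_insert_self a F)
    rw [Finset.sup_insert, Finset.sum_insert ha]
    exact ⟨inferInstance, (Submodule.finrank_add_le_finrank_add_finrank _ _).trans (by omega)⟩

/-- Right multiplication by t is injective and sends elements with fixed space X to elements with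
fixed space X ∩ H_t = Y; the condition X ≠ Y says that H_t does not contain X. This mirrors A_Y
being spanned by the a_t A_X. -/
theorem card_fixedSpace_mem_le [Fintype W] [DecidableEq (Submodule ℝ (B → ℝ))]
    (t : Refl cs.simple) (Y : Submodule ℝ (B → ℝ)) (F : Finset (Submodule ℝ (B → ℝ)))
    (hF : ∀ X ∈ F, X ⊓ fixedSpace (geomRep cs) t.1 = Y ∧ X ≠ Y) :
    ∑ X ∈ F, (Finset.univ.filter fun w : W => fixedSpace (geomRep cs) w = X).card ≤
      (Finset.univ.filter fun w : W => fixedSpace (geomRep cs) w = Y).card := by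
  classical
  rw [← Finset.card_biUnion]
  · refine Finset.card_le_card_of_injOn (fun w => w * t.1) ?_
      ((mul_left_injective t.1).injOn)
    intro w hw
    simp only [Finset.coe_biUnion, Set.mem_iUnion, Finset.mem_coe, Finset.mem_filter,
      Finset.mem_univ, true_and] at hw
    obtain ⟨X, hX, hw⟩ := hw
    obtain ⟨h1, h2⟩ := hF X hX
    have h3 : ¬ fixedSpace (geomRep cs) w ≤ fixedSpace (geomRep cs) t.1 := by
      rw [hw]
      intro h
      exact h2 (by rw [← h1, inf_eq_left.2 h])
    simp [fixedSpace_mul_refl cs t w h3, hw, h1]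
  · intro X _ X' _ hne
    rw [Function.onFun, Finset.disjoint_left]
    intro w hw hw'
    simp only [Finset.mem_filter, Finset.mem_univ, true_and] at hw hw'
    exact hne (hw.symm.trans hw')

/-- The dimension of the component `A_Y` of the Orlik-Solomon algebra is at most the number of
elements with fixed space `Y`. -/
theorem finrank_osComponent_le [Fintype W] [DecidableEq (Submodule ℝ (B → ℝ))]
    (p : ℕ) (Y : Submodule ℝ (B → ℝ))
    (hp : p + Module.finrank ℝ Y = Module.finrank ℝ (B → ℝ)) :
    Module.Finite ℂ (osComponent cs.simple (geomRep cs) Y) ∧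
      Module.finrank ℂ (osComponent cs.simple (geomRep cs) Y) ≤
        (Finset.univ.filter fun w : W => fixedSpace (geomRep cs) w = Y).card := by
  induction p generalizing Y with
  | zero =>
    have hY : Y = ⊤ := Submodule.eq_top_of_finrank_eq (by omega)
    subst hY
    have hle : osComponent cs.simple (geomRep cs) ⊤ ≤
        Submodule.span ℂ {osMonomial cs.simple (geomRep cs) []} := by
      refine Submodule.span_mono ?_
      rintro _ ⟨l, -, hl, rfl⟩
      have : l = [] := List.length_eq_zero_iff.1 (by omega)
      rw [this]; rfl
    refine ⟨Submodule.finiteDimensional_of_le hle,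
      (Submodule.finrank_mono hle).trans ((finrank_span_le_card _).trans ?_)⟩
    rw [Set.toFinset_singleton, Finset.card_singleton]
    refine Finset.card_pos.2 ⟨1, Finset.mem_filter.2 ⟨Finset.mem_univ _, ?_⟩⟩
    ext v
    simp [mem_fixedSpace]
  | succ p ih =>
    by_cases hex : ∃ t : Refl cs.simple, Y ≤ fixedSpace (geomRep cs) t.1
    · obtain ⟨t, ht⟩ := hex
      -- The spaces X of codimension one less than Y with X ∩ H_t = Y, restricted to fixed spaces of
      -- group elements so that there are finitely many. The goal is to show that A_Y lies in the
      -- sum of the a_t A_X.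
      let F : Finset (Submodule ℝ (B → ℝ)) := (Finset.univ.image (fixedSpace (geomRep cs))).filter
        fun X => X ⊓ fixedSpace (geomRep cs) t.1 = Y ∧
          p + Module.finrank ℝ X = Module.finrank ℝ (B → ℝ)
      have hF : ∀ X ∈ F, X ⊓ fixedSpace (geomRep cs) t.1 = Y ∧
          p + Module.finrank ℝ X = Module.finrank ℝ (B → ℝ) := fun X hX =>
        (Finset.mem_filter.1 hX).2
      let a := LinearMap.mulLeft ℂ (osMonomial cs.simple (geomRep cs) [t])
      let U : Submodule ℝ (B → ℝ) → Submodule ℂ (OSAlgebra cs.simple (geomRep cs)) :=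
        fun X => (osComponent cs.simple (geomRep cs) X).map a
      have hle : osComponent cs.simple (geomRep cs) Y ≤ F.sup U := by
        refine Submodule.span_le.2 ?_
        rintro _ ⟨l, hl, hlen, rfl⟩
        have hdep : IsDependent cs.simple (geomRep cs) (t :: l) := by
          rw [IsDependent, flat_cons, hl, inf_eq_right.2 ht, List.length_cons]
          omega
        rw [osMonomial_eq_sum_of_isDependent _ _ hdep]
        refine Submodule.sum_mem _ fun i hi => Submodule.smul_mem _ _ ?_
        rw [← osMonomial_cons]
        by_cases hd : IsDependent cs.simple (geomRep cs) (t :: l.eraseIdx i)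
        · rw [osMonomial_eq_zero_of_isDependent _ _ hd]
          exact Submodule.zero_mem _
        have hi' : i < l.length := Finset.mem_range.1 hi
        have hei : (l.eraseIdx i).length = p := by
          rw [List.length_eraseIdx_of_lt hi']; omega
        set X := flat cs.simple (geomRep cs) (l.eraseIdx i) with hX
        have hYX : Y ≤ X := by
          rw [hX, le_flat_iff]
          intro r hr
          exact (le_flat_iff _ _ Y l).1 hl.ge r (List.mem_of_mem_eraseIdx hr)
        rw [IsDependent, flat_cons, List.length_cons, ← hX, hei, not_lt] at hd
        have hXY : X ⊓ fixedSpace (geomRep cs) t.1 = Y := by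
          rw [inf_comm]
          exact (Submodule.eq_of_le_of_finrank_le (le_inf ht hYX) (by omega)).symm
        have hXp : p + Module.finrank ℝ X = Module.finrank ℝ (B → ℝ) := by
          have h1 := finrank_le_finrank_fixedSpace_inf_add_one cs t X
          have h2 := finrank_le_finrank_flat_add_length cs (l.eraseIdx i)
          rw [← hX] at h2
          omega
        have hmem : osMonomial cs.simple (geomRep cs) (l.eraseIdx i) ∈
            osComponent cs.simple (geomRep cs) X :=
          Submodule.subset_span ⟨_, hX.symm, by rw [hei, hXp], rfl⟩
        rw [osMonomial_cons]
        -- If X is not the fixed space of any element, the inductive bound is 0, so A_X = 0 and the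
        -- term vanishes.
        by_cases hXF : X ∈ F
        · exact Finset.le_sup (f := U) hXF ⟨_, hmem, rfl⟩
        · obtain ⟨hfin, hcard⟩ := ih X hXp
          have hempty : (Finset.univ.filter fun w : W => fixedSpace (geomRep cs) w = X) = ∅ := by
            rw [Finset.filter_eq_empty_iff]
            intro w _ hw
            exact hXF (Finset.mem_filter.2
              ⟨Finset.mem_image.2 ⟨w, Finset.mem_univ w, hw⟩, hXY, hXp⟩)
          rw [hempty, Finset.card_empty, Nat.le_zero, Submodule.finrank_eq_zero] at hcard
          rw [hcard, Submodule.mem_bot] at hmem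
          rw [hmem, mul_zero]
          exact Submodule.zero_mem _
      have hfin : ∀ X ∈ F, Module.Finite ℂ (U X) := fun X hX => by
        have := (ih X (hF X hX).2).1
        exact Module.Finite.map _ _
      obtain ⟨h1, h2⟩ := finrank_finset_sup_le F U hfin
      refine ⟨Submodule.finiteDimensional_of_le hle, (Submodule.finrank_mono hle).trans
        (h2.trans (le_trans (Finset.sum_le_sum fun X hX => ?_)
          (card_fixedSpace_mem_le cs t Y F fun X hX => ⟨(hF X hX).1, ?_⟩)))⟩
      · obtain ⟨h3, h4⟩ := ih X (hF X hX).2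
        exact (Submodule.finrank_map_le a _).trans h4
      · rintro rfl
        have := (hF X hX).2
        omega
    · have hbot : osComponent cs.simple (geomRep cs) Y = ⊥ := by
        rw [osComponent, Submodule.span_eq_bot]
        rintro _ ⟨l, hl, hlen, rfl⟩
        cases l with
        | nil => rw [List.length_nil] at hlen; omega
        | cons t l => exact absurd ⟨t, (le_flat_iff _ _ Y _).1 hl.ge t (by simp)⟩ hex
      rw [hbot]
      exact ⟨inferInstance, by simp⟩

end DimensionBound

/-- The trace of an endomorphism on a subspace is unchanged under transport along an injective
linear map. -/
theorem trace_restrict_map {K E F : Type*} [Field K] [AddCommGroup E] [Module K E]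
    [AddCommGroup F] [Module K F] (f : E →ₗ[K] F) (hf : Function.Injective f)
    (P : Submodule K E) (Q : Submodule K F) (hQ : P.map f = Q) (φ : E →ₗ[K] E) (ψ : F →ₗ[K] F)
    (h : ∀ x ∈ P, f (φ x) = ψ (f x)) (hφ : ∀ x ∈ P, φ x ∈ P) (hψ : ∀ x ∈ Q, ψ x ∈ Q) :
    LinearMap.trace K Q (ψ.restrict hψ) = LinearMap.trace K P (φ.restrict hφ) := by
  subst hQ
  let e := Submodule.equivMapOfInjective f hf P
  rw [← LinearMap.trace_conj' (φ.restrict hφ) e]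
  congr 1
  refine LinearMap.ext fun y => ?_
  obtain ⟨x, rfl⟩ := e.surjective y
  apply Subtype.ext
  rw [LinearEquiv.conj_apply_apply, LinearEquiv.symm_apply_apply]
  exact (h x x.2).symm

/-! ### The Orlik–Solomon algebra of W_L as a retract of that of W -/

section OrlikSolomonParabolic

variable {B W : Type*} [Fintype B] [DecidableEq B] [Group W] {M : CoxeterMatrix B}
variable (cs : CoxeterSystem M W) (L : Finset B)

/-- A reflection of `W_L`, as a reflection of `W`. -/
def reflIncl (t : Refl (parabolicSimple cs L)) : Refl cs.simple :=
  ⟨(t.1 : W), by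
    obtain ⟨i, g, h⟩ := t.2
    exact ⟨i, g, by rw [h]; rfl⟩⟩

omit [Fintype B] [DecidableEq B] in
theorem reflIncl_injective : Function.Injective (reflIncl cs L) := fun _ _ h =>
  Subtype.ext (Subtype.ext (congrArg (fun r : Refl cs.simple => r.1) h))

theorem mem_fixedSpace_parabolicRep {w : parabolic cs L} {v : parabolicSpace L} :
    v ∈ fixedSpace (parabolicRep cs L) w ↔ (v : B → ℝ) ∈ fixedSpace (geomRep cs) (w : W) := by
  rw [mem_fixedSpace, mem_fixedSpace, Subtype.ext_iff]
  rfl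

theorem fixedBy_le_fixedSpace {w : W} (hw : w ∈ parabolic cs L) :
    fixedBy (geomRep cs) (parabolic cs L) ≤ fixedSpace (geomRep cs) w := fun _ hv =>
  mem_fixedSpace.2 (mem_fixedBy.1 hv w hw)

theorem mem_flat_parabolic {l : List (Refl (parabolicSimple cs L))} {v : parabolicSpace L} :
    v ∈ flat (parabolicSimple cs L) (parabolicRep cs L) l ↔
      (v : B → ℝ) ∈ flat cs.simple (geomRep cs) (l.map (reflIncl cs L)) := by
  simp only [flat, Submodule.mem_iInf, List.forall_mem_map]
  exact forall₂_congr fun t _ => mem_fixedSpace_parabolicRep cs L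

theorem fixedBy_le_flat (l : List (Refl (parabolicSimple cs L))) :
    fixedBy (geomRep cs) (parabolic cs L) ≤
      flat cs.simple (geomRep cs) (l.map (reflIncl cs L)) := by
  rw [le_flat_iff, List.forall_mem_map]
  exact fun t _ => fixedBy_le_fixedSpace cs L t.1.2

variable [Finite W]

theorem finrank_parabolicSpace_add :
    Module.finrank ℝ (parabolicSpace L) +
      Module.finrank ℝ (fixedBy (geomRep cs) (parabolic cs L)) = Module.finrank ℝ (B → ℝ) :=
  Submodule.finrank_add_eq_of_isCompl (isCompl_parabolicSpace_fixedBy cs L)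

/-- For a subspace `Z ≥ Fix(W_L)` of `V`, `Z` is the sum of `Z ∩ V_L` and `Fix(W_L)`. -/
theorem map_subtype_sup_fixedBy {X : Submodule ℝ (parabolicSpace L)} {Z : Submodule ℝ (B → ℝ)}
    (hXZ : ∀ v : parabolicSpace L, v ∈ X ↔ (v : B → ℝ) ∈ Z)
    (hZ : fixedBy (geomRep cs) (parabolic cs L) ≤ Z) :
    X.map (parabolicSpace L).subtype ⊔ fixedBy (geomRep cs) (parabolic cs L) = Z := by
  apply le_antisymm
  · refine sup_le ?_ hZ
    rintro _ ⟨v, hv, rfl⟩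
    exact (hXZ v).1 hv
  · intro v hv
    have hv' : v ∈ parabolicSpace L ⊔ fixedBy (geomRep cs) (parabolic cs L) := by
      rw [(isCompl_parabolicSpace_fixedBy cs L).sup_eq_top]; trivial
    obtain ⟨a, ha, y, hy, rfl⟩ := Submodule.mem_sup.1 hv'
    refine Submodule.add_mem_sup ⟨⟨a, ha⟩, (hXZ _).2 ?_, rfl⟩ hy
    simpa using Submodule.sub_mem _ hv (hZ hy)

theorem finrank_add_finrank_fixedBy {X : Submodule ℝ (parabolicSpace L)}
    {Z : Submodule ℝ (B → ℝ)} (hXZ : ∀ v : parabolicSpace L, v ∈ X ↔ (v : B → ℝ) ∈ Z)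
    (hZ : fixedBy (geomRep cs) (parabolic cs L) ≤ Z) :
    Module.finrank ℝ X + Module.finrank ℝ (fixedBy (geomRep cs) (parabolic cs L)) =
      Module.finrank ℝ Z := by
  have h1 := Submodule.finrank_sup_add_finrank_inf_eq (X.map (parabolicSpace L).subtype)
    (fixedBy (geomRep cs) (parabolic cs L))
  have h2 : X.map (parabolicSpace L).subtype ⊓ fixedBy (geomRep cs) (parabolic cs L) = ⊥ :=
    disjoint_iff.1 ((isCompl_parabolicSpace_fixedBy cs L).disjoint.mono_left
      (Submodule.map_subtype_le _ _))
  rw [h2, finrank_bot, map_subtype_sup_fixedBy cs L hXZ hZ,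
    Submodule.finrank_map_subtype_eq] at h1
  omega

theorem eq_bot_iff_eq_fixedBy {X : Submodule ℝ (parabolicSpace L)}
    {Z : Submodule ℝ (B → ℝ)} (hXZ : ∀ v : parabolicSpace L, v ∈ X ↔ (v : B → ℝ) ∈ Z)
    (hZ : fixedBy (geomRep cs) (parabolic cs L) ≤ Z) :
    X = ⊥ ↔ Z = fixedBy (geomRep cs) (parabolic cs L) := by
  have h1 := finrank_add_finrank_fixedBy cs L hXZ hZ
  constructor
  · rintro rfl
    rw [finrank_bot] at h1
    exact (Submodule.eq_of_le_of_finrank_eq hZ (by omega)).symm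
  · intro h
    rw [h] at h1
    exact Submodule.finrank_eq_zero.1 (by omega)

theorem finrank_flat_parabolic (l : List (Refl (parabolicSimple cs L))) :
    Module.finrank ℝ (flat (parabolicSimple cs L) (parabolicRep cs L) l) +
      Module.finrank ℝ (fixedBy (geomRep cs) (parabolic cs L)) =
      Module.finrank ℝ (flat cs.simple (geomRep cs) (l.map (reflIncl cs L))) :=
  finrank_add_finrank_fixedBy cs L (fun _ => mem_flat_parabolic cs L) (fixedBy_le_flat cs L l)

/-- All hyperplanes involved contain Fix(W_L), a complement of V_L, so codimensions in V_L and in V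
agree. -/
theorem isDependent_map_reflIncl {l : List (Refl (parabolicSimple cs L))} :
    IsDependent cs.simple (geomRep cs) (l.map (reflIncl cs L)) ↔
      IsDependent (parabolicSimple cs L) (parabolicRep cs L) l := by
  rw [IsDependent, IsDependent, ← finrank_flat_parabolic, ← finrank_parabolicSpace_add cs L,
    List.length_map]
  omega

theorem exists_reflIncl_eq (t : Refl cs.simple)
    (ht : fixedBy (geomRep cs) (parabolic cs L) ≤ fixedSpace (geomRep cs) t.1) :
    ∃ t', reflIncl cs L t' = t := by
  obtain ⟨i, hi, g, hg, h⟩ := exists_parabolic_conj_of_fixedBy_le cs L t ht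
  let g' : parabolic cs L := ⟨g, hg⟩
  exact ⟨⟨g'⁻¹ * parabolicSimple cs L ⟨i, hi⟩ * g', ⟨⟨i, hi⟩, g', rfl⟩⟩, Subtype.ext h.symm⟩

omit [Fintype B] [DecidableEq B] [Finite W] in
theorem exists_map_reflIncl_eq (l : List (Refl cs.simple))
    (hl : ∀ t ∈ l, t ∈ Set.range (reflIncl cs L)) :
    ∃ l' : List (Refl (parabolicSimple cs L)), l'.map (reflIncl cs L) = l := by
  rwa [← Set.mem_range, Set.range_list_map, Set.mem_ofPred_eq]

/-- The homomorphism of free algebras induced by the inclusion of reflections. -/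
def freeIncl : FreeAlgebra ℂ (Refl (parabolicSimple cs L)) →ₐ[ℂ] FreeAlgebra ℂ (Refl cs.simple) :=
  FreeAlgebra.lift ℂ fun t => FreeAlgebra.ι ℂ (reflIncl cs L t)

omit [Fintype B] [DecidableEq B] [Finite W] in
theorem freeIncl_monomial (l : List (Refl (parabolicSimple cs L))) :
    freeIncl cs L (monomial _ l) = monomial _ (l.map (reflIncl cs L)) := by
  simp [freeIncl, monomial, map_list_prod, Function.comp_def]

omit [Fintype B] [DecidableEq B] [Finite W] in
theorem freeIncl_boundary (l : List (Refl (parabolicSimple cs L))) :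
    freeIncl cs L (boundary _ l) = boundary _ (l.map (reflIncl cs L)) := by
  simp [boundary, map_sum, freeIncl_monomial, List.eraseIdx_map]

/-- The homomorphism from the Orlik-Solomon algebra of `W_L` to that of `W`. -/
def osIncl : OSAlgebra (parabolicSimple cs L) (parabolicRep cs L) →ₐ[ℂ]
    OSAlgebra cs.simple (geomRep cs) :=
  RingQuot.liftAlgHom ℂ ⟨(RingQuot.mkAlgHom ℂ _).comp (freeIncl cs L), by
    intro x y h
    rw [AlgHom.comp_apply, AlgHom.comp_apply]
    cases h with
    | anticomm t t' =>
      rw [map_neg, freeIncl_monomial, freeIncl_monomial]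
      exact RingQuot.mkAlgHom_rel ℂ (OSRel.anticomm _ _)
    | dependent l h =>
      rw [map_zero, freeIncl_boundary]
      exact RingQuot.mkAlgHom_rel ℂ (OSRel.dependent _ ((isDependent_map_reflIncl cs L).2 h))⟩

theorem osIncl_osMonomial (l : List (Refl (parabolicSimple cs L))) :
    osIncl cs L (osMonomial _ _ l) = osMonomial _ _ (l.map (reflIncl cs L)) := by
  rw [osIncl, osMonomial, RingQuot.liftAlgHom_mkAlgHom_apply, AlgHom.comp_apply,
    freeIncl_monomial]
  rfl

open scoped Classical in
/-- The homomorphism from the free algebra that kills the reflections outside `W_L`. -/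
def freeProj : FreeAlgebra ℂ (Refl cs.simple) →ₐ[ℂ]
    OSAlgebra (parabolicSimple cs L) (parabolicRep cs L) :=
  FreeAlgebra.lift ℂ fun t =>
    if h : ∃ t', reflIncl cs L t' = t then osMonomial _ _ [h.choose] else 0

omit [Finite W] in
theorem freeProj_ι_reflIncl (t : Refl (parabolicSimple cs L)) :
    freeProj cs L (FreeAlgebra.ι ℂ (reflIncl cs L t)) = osMonomial _ _ [t] := by
  have h : ∃ t', reflIncl cs L t' = reflIncl cs L t := ⟨t, rfl⟩
  rw [freeProj, FreeAlgebra.lift_ι_apply, dif_pos h, reflIncl_injective cs L h.choose_spec]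

omit [Finite W] in
theorem freeProj_monomial_map (l : List (Refl (parabolicSimple cs L))) :
    freeProj cs L (monomial _ (l.map (reflIncl cs L))) = osMonomial _ _ l := by
  induction l with
  | nil => simp [monomial, osMonomial]
  | cons t l ih =>
    have h : monomial cs.simple ((t :: l).map (reflIncl cs L)) =
        FreeAlgebra.ι ℂ (reflIncl cs L t) * monomial cs.simple (l.map (reflIncl cs L)) := by
      simp [monomial]
    rw [h, map_mul, ih, freeProj_ι_reflIncl, ← osMonomial_cons]

omit [Finite W] in
theorem freeProj_monomial_eq_zero {l : List (Refl cs.simple)} {t : Refl cs.simple} (ht : t ∈ l)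
    (ht' : t ∉ Set.range (reflIncl cs L)) : freeProj cs L (monomial _ l) = 0 := by
  rw [monomial, map_list_prod, List.map_map]
  apply List.prod_eq_zero
  rw [List.mem_map]
  refine ⟨t, ht, ?_⟩
  rw [Function.comp_apply, freeProj, FreeAlgebra.lift_ι_apply]
  exact dif_neg ht'

omit [Finite W] in
theorem isDependent_of_cons_of_not_fixedBy_le {t : Refl cs.simple} {l : List (Refl cs.simple)}
    (h : IsDependent cs.simple (geomRep cs) (t :: l)) {Y : Submodule ℝ (B → ℝ)}
    (hY : Y ≤ flat cs.simple (geomRep cs) l) (ht : ¬ Y ≤ fixedSpace (geomRep cs) t.1) :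
    IsDependent cs.simple (geomRep cs) l := by
  have hlt : fixedSpace (geomRep cs) t.1 ⊓ flat cs.simple (geomRep cs) l <
      flat cs.simple (geomRep cs) l :=
    inf_le_right.lt_of_ne fun h' => ht (hY.trans (inf_eq_right.1 h'))
  have := Submodule.finrank_lt_finrank_of_lt hlt
  rw [IsDependent, flat_cons, List.length_cons] at h
  rw [IsDependent]
  omega

omit [Finite W] in
theorem flat_perm {l l' : List (Refl cs.simple)} (h : l.Perm l') :
    flat cs.simple (geomRep cs) l = flat cs.simple (geomRep cs) l' := by
  simp only [flat, h.mem_iff]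

/-- If every reflection lies in W_L, this is a relation of W_L. Otherwise a term survives only if it
deletes the one reflection t outside W_L. Then H_t does not contain Fix(W_L) while the other
hyperplanes do, so t is independent of them; the dependence lies among the others, and their
monomial is already zero. -/
theorem freeProj_boundary {l : List (Refl cs.simple)}
    (hl : IsDependent cs.simple (geomRep cs) l) : freeProj cs L (boundary _ l) = 0 := by
  by_cases hall : ∀ t ∈ l, t ∈ Set.range (reflIncl cs L)
  · obtain ⟨l', rfl⟩ := exists_map_reflIncl_eq cs L l hall
    rw [isDependent_map_reflIncl] at hl
    have h := RingQuot.mkAlgHom_rel ℂ (OSRel.dependent l' hl)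
    rw [map_zero] at h
    rw [← h, boundary, boundary, map_sum, map_sum, List.length_map]
    refine Finset.sum_congr rfl fun i _ => ?_
    rw [map_smul, map_smul, List.eraseIdx_map, freeProj_monomial_map]
    rfl
  · push Not at hall
    obtain ⟨t, ht, htL⟩ := hall
    rw [boundary, map_sum]
    refine Finset.sum_eq_zero fun i hi => ?_
    rw [map_smul]
    have hi' : i < l.length := Finset.mem_range.1 hi
    suffices freeProj cs L (monomial _ (l.eraseIdx i)) = 0 by rw [this, smul_zero]
    by_cases hall' : ∀ t ∈ l.eraseIdx i, t ∈ Set.range (reflIncl cs L)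
    · obtain ⟨l', hl'⟩ := exists_map_reflIncl_eq cs L _ hall'
      have hperm : (l[i] :: l.eraseIdx i).Perm l := List.getElem_cons_eraseIdx_perm hi'
      have hti : t = l[i] := by
        rcases List.mem_cons.1 (hperm.mem_iff.2 ht) with h | h
        · exact h
        · exact absurd (hall' t h) htL
      have hdep : IsDependent cs.simple (geomRep cs) (t :: l.eraseIdx i) := by
        rw [← hti] at hperm
        rw [IsDependent, flat_perm cs hperm, hperm.length_eq]
        exact hl
      have h := isDependent_of_cons_of_not_fixedBy_le cs hdep
        (hl' ▸ fixedBy_le_flat cs L l') fun h => htL (exists_reflIncl_eq cs L t h)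
      rw [← hl', isDependent_map_reflIncl] at h
      rw [← hl', freeProj_monomial_map, osMonomial_eq_zero_of_isDependent _ _ h]
    · push Not at hall'
      obtain ⟨t', ht', htL'⟩ := hall'
      exact freeProj_monomial_eq_zero cs L ht' htL'

omit [Finite W] in
theorem freeProj_anticomm (t t' : Refl cs.simple) :
    freeProj cs L (monomial _ [t, t']) = freeProj cs L (-monomial _ [t', t]) := by
  rw [map_neg]
  by_cases h : t ∈ Set.range (reflIncl cs L)
  · by_cases h' : t' ∈ Set.range (reflIncl cs L)
    · obtain ⟨r, rfl⟩ := h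
      obtain ⟨r', rfl⟩ := h'
      have e1 := freeProj_monomial_map cs L [r, r']
      have e2 := freeProj_monomial_map cs L [r', r]
      have e3 := RingQuot.mkAlgHom_rel ℂ (OSRel.anticomm (ρ := parabolicRep cs L) r r')
      rw [map_neg] at e3
      rw [List.map_cons, List.map_singleton] at e1 e2
      rw [e1, e2]
      exact e3
    · rw [freeProj_monomial_eq_zero cs L (t := t') (by simp) h',
        freeProj_monomial_eq_zero cs L (t := t') (by simp) h', neg_zero]
  · rw [freeProj_monomial_eq_zero cs L (t := t) (by simp) h,
      freeProj_monomial_eq_zero cs L (t := t) (by simp) h, neg_zero]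

/-- The retraction from the Orlik-Solomon algebra of `W` onto that of `W_L`. -/
def osProj : OSAlgebra cs.simple (geomRep cs) →ₐ[ℂ]
    OSAlgebra (parabolicSimple cs L) (parabolicRep cs L) :=
  RingQuot.liftAlgHom ℂ ⟨freeProj cs L, by
    intro x y h
    cases h with
    | anticomm t t' => exact freeProj_anticomm cs L t t'
    | dependent l h => rw [map_zero, freeProj_boundary cs L h]⟩

theorem osProj_osIncl (a : OSAlgebra (parabolicSimple cs L) (parabolicRep cs L)) :
    osProj cs L (osIncl cs L a) = a := by
  have h : (osProj cs L).comp (osIncl cs L) = AlgHom.id ℂ _ := by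
    refine RingQuot.ringQuot_ext' ℂ _ _ ?_
    refine FreeAlgebra.hom_ext (funext fun t => ?_)
    have h1 : osMonomial (parabolicSimple cs L) (parabolicRep cs L) [t] =
        RingQuot.mkAlgHom ℂ _ (FreeAlgebra.ι ℂ t) := by simp [osMonomial, monomial]
    have h2 := osIncl_osMonomial cs L [t]
    have h3 := freeProj_monomial_map cs L [t]
    simp only [Function.comp_apply, AlgHom.comp_apply, AlgHom.id_apply]
    rw [← h1, h2, osMonomial, osProj, RingQuot.liftAlgHom_mkAlgHom_apply, h3]
  exact congrArg (fun f => f a) h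

theorem osIncl_injective : Function.Injective (osIncl cs L) :=
  Function.LeftInverse.injective (osProj_osIncl cs L)

/-- A monomial with flat Fix(W_L) involves only reflections whose hyperplane contains Fix(W_L), and
these are the reflections of W_L. -/
theorem map_osIncl_osComponent :
    (osComponent (parabolicSimple cs L) (parabolicRep cs L) ⊥).map (osIncl cs L).toLinearMap =
      osComponent cs.simple (geomRep cs) (fixedBy (geomRep cs) (parabolic cs L)) := by
  rw [osComponent, Submodule.map_span]
  congr 1
  have hV := finrank_parabolicSpace_add cs L
  have hflat : ∀ l, flat (parabolicSimple cs L) (parabolicRep cs L) l = ⊥ ↔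
      flat cs.simple (geomRep cs) (l.map (reflIncl cs L)) =
        fixedBy (geomRep cs) (parabolic cs L) := fun l =>
    eq_bot_iff_eq_fixedBy cs L (fun _ => mem_flat_parabolic cs L) (fixedBy_le_flat cs L l)
  ext a
  constructor
  · rintro ⟨_, ⟨l, hl, hp, rfl⟩, rfl⟩
    rw [finrank_bot] at hp
    refine ⟨l.map (reflIncl cs L), (hflat l).1 hl, ?_, osIncl_osMonomial cs L l⟩
    rw [List.length_map]
    omega
  · rintro ⟨l, hl, hp, rfl⟩
    obtain ⟨l', rfl⟩ := exists_map_reflIncl_eq cs L l fun t ht =>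
      exists_reflIncl_eq cs L t ((le_flat_iff _ _ _ l).1 hl.ge t ht)
    refine ⟨_, ⟨l', (hflat l').2 hl, ?_, rfl⟩, osIncl_osMonomial cs L l'⟩
    rw [List.length_map] at hp
    rw [finrank_bot]
    omega

theorem osIncl_osAct (g : parabolic cs L)
    (a : OSAlgebra (parabolicSimple cs L) (parabolicRep cs L)) :
    osIncl cs L (osAct _ _ g a) = osAct _ _ (g : W) (osIncl cs L a) := by
  have h : (osIncl cs L).comp (osAct _ _ g) = (osAct _ _ (g : W)).comp (osIncl cs L) := by
    refine RingQuot.ringQuot_ext' ℂ _ _ ?_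
    refine FreeAlgebra.hom_ext (funext fun t => ?_)
    have h1 : osMonomial (parabolicSimple cs L) (parabolicRep cs L) [t] =
        RingQuot.mkAlgHom ℂ _ (FreeAlgebra.ι ℂ t) := by simp [osMonomial, monomial]
    simp only [Function.comp_apply, AlgHom.comp_apply]
    rw [← h1, osIncl_osMonomial, osAct_osMonomial, osAct_osMonomial, osIncl_osMonomial]
    rfl
  exact congrArg (fun f => f a) h

/-- The restriction of the extension of `Ψ_L` to `W_L` is `Ψ_L`. -/
theorem PsiTilde_eq_Psi (g : parabolic cs L) (hg : (g : W) ∈ parabolicNormalizer cs L) :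
    PsiTilde cs L ⟨g, hg⟩ = Psi (parabolicSimple cs L) (parabolicRep cs L) g :=
  trace_restrict_map (osIncl cs L).toLinearMap (osIncl_injective cs L) _ _
    (map_osIncl_osComponent cs L) _ _ (fun a _ => osIncl_osAct cs L g a) _ _

end OrlikSolomonParabolic

/-! ### Invariance of the descent algebra under automorphisms permuting the generators -/

section Relabel

open scoped Classical

variable {G B : Type*} [Group G] {s : B → G} {c : G ≃* G} {σ : B ≃ B}

theorem wordLength_map (h : ∀ i, c (s i) = s (σ i)) (g : G) :
    wordLength s (c g) = wordLength s g := by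
  have hc : ∀ ω : List B, ((ω.map σ).map s).prod = c (ω.map s).prod := fun ω => by
    rw [map_list_prod, List.map_map, List.map_map]
    congr 1
    exact List.map_congr_left fun i _ => (h i).symm
  rw [wordLength, wordLength]
  congr 1
  ext n
  constructor
  · rintro ⟨ω, h1, h2⟩
    refine ⟨ω.map σ.symm, by rw [List.length_map, h1], c.injective ?_⟩
    have h3 : (ω.map σ.symm).map σ = ω := by simp
    rw [← hc, h3, h2]
  · rintro ⟨ω, h1, h2⟩
    exact ⟨ω.map σ, by rw [List.length_map, h1], by rw [hc, h2]⟩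

theorem mem_X_map_iff (h : ∀ i, c (s i) = s (σ i)) (J : Finset B) (x : G) :
    c x ∈ X s (J.map σ.toEmbedding) ↔ x ∈ X s J := by
  simp only [X, Set.mem_ofPred_eq, Finset.forall_mem_map, Equiv.coe_toEmbedding, ← h, ← map_mul,
    wordLength_map h]

theorem mem_Xsharp_map_iff (h : ∀ i, c (s i) = s (σ i)) (J : Finset B) (x : G) :
    c x ∈ Xsharp s (J.map σ.toEmbedding) ↔ x ∈ Xsharp s J := by
  simp only [Xsharp, Set.mem_ofPred_eq, mem_X_map_iff h, Finset.forall_mem_map,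
    Equiv.coe_toEmbedding, ← h, ← map_mul, ← map_inv]
  refine and_congr_right fun _ => forall₂_congr fun i _ => ?_
  constructor
  · rintro ⟨k, hk⟩
    exact ⟨σ.symm k, c.injective (by rw [hk, h, σ.apply_symm_apply])⟩
  · rintro ⟨k, hk⟩
    exact ⟨σ k, by rw [hk, h]⟩

theorem mMatrix_map (h : ∀ i, c (s i) = s (σ i)) (K L : Finset B) :
    mMatrix s (K.map σ.toEmbedding) (L.map σ.toEmbedding) = mMatrix s K L := by
  simp only [mMatrix, Finset.map_subset_map]
  congr 2
  refine (Nat.card_congr (c.toEquiv.subtypeEquiv fun x => ?_)).symm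
  exact (and_congr (mem_X_map_iff h K x) (mem_Xsharp_map_iff h L x)).symm

theorem xElt_map [Finite G] (h : ∀ i, c (s i) = s (σ i)) (J : Finset B) :
    MonoidAlgebra.mapDomainAlgHom ℂ ℂ c.toMonoidHom (xElt s J) =
      xElt s (J.map σ.toEmbedding) := by
  have := AddMonoidHom.map_finsum_mem (s := X s J)
    (fun x => MonoidAlgebra.single x⁻¹ (1 : ℂ))
    (MonoidAlgebra.mapDomainAlgHom ℂ ℂ c.toMonoidHom : _ →+ MonoidAlgebra ℂ G) (Set.toFinite _)
  refine this.trans ?_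
  refine finsum_mem_eq_of_bijOn c ⟨fun x hx => (mem_X_map_iff h J x).2 hx, c.injective.injOn,
    fun y hy => ⟨c.symm y, ?_, c.apply_symm_apply y⟩⟩ fun x _ => ?_
  · rwa [← mem_X_map_iff h, c.apply_symm_apply]
  · simp

/-- The matrix m is invariant under the relabelling, and matrix inversion commutes with reindexing,
so m⁻¹ is invariant too. For the full set of generators this says that e is fixed by the
automorphism. -/
theorem eElt_map [Fintype B] [Finite G] (h : ∀ i, c (s i) = s (σ i)) (L : Finset B) :
    MonoidAlgebra.mapDomainAlgHom ℂ ℂ c.toMonoidHom (eElt s L) =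
      eElt s (L.map σ.toEmbedding) := by
  have hM : (mMatrix s).submatrix σ.finsetCongr σ.finsetCongr = mMatrix s := by
    ext K L
    exact mMatrix_map h K L
  have hinv := Matrix.inv_submatrix_equiv (mMatrix s) σ.finsetCongr σ.finsetCongr
  rw [hM] at hinv
  rw [eElt, eElt, map_sum]
  conv_rhs => rw [← σ.finsetCongr.sum_comp]
  refine Finset.sum_congr rfl fun K _ => ?_
  rw [map_smul, xElt_map h]
  congr 1
  exact congrFun (congrFun hinv L) K

end Relabel

/-! ### The top component of the group algebra of W_L inside that of W -/

section TopComponent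

variable {B W : Type*} [Fintype B] [DecidableEq B] [Group W] [Finite W] {M : CoxeterMatrix B}
variable (cs : CoxeterSystem M W) (L : Finset B)

/-- The inclusion `ℂW_L → ℂW`. -/
abbrev algIncl : MonoidAlgebra ℂ (parabolic cs L) →ₐ[ℂ] MonoidAlgebra ℂ W :=
  MonoidAlgebra.mapDomainAlgHom ℂ ℂ (parabolic cs L).subtype

/-- `x_L a` determines `a ∈ ℂW_L`. -/
theorem coeff_xElt_mul_algIncl (a : MonoidAlgebra ℂ (parabolic cs L)) (u : parabolic cs L) :
    (xElt cs.simple L * algIncl cs L a).coeff (u : W) = a.coeff u := by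
  classical
  have hincl : ∀ v : W, (algIncl cs L a).coeff v =
      if h : v ∈ parabolic cs L then a.coeff ⟨v, h⟩ else 0 := by
    intro v
    split_ifs with h
    · exact Finsupp.mapDomain_apply (Subtype.val_injective) a.coeff ⟨v, h⟩
    · exact Finsupp.mapDomain_of_notMem_range a.coeff v (by simpa using h)
  rw [xElt, finsum_mem_eq_finite_toFinset_sum _ (Set.toFinite _), Finset.sum_mul,
    MonoidAlgebra.coeff_sum, Finsupp.finsetSum_apply,
    Finset.sum_eq_single 1]
  · rw [MonoidAlgebra.coeff_single_mul_apply, hincl]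
    simp
  -- A summand x⁻¹ a contributes at u ∈ W_L only if x ∈ W_L, and 1 is the only element of X_L in
  -- W_L.
  · intro x hx hx1
    rw [MonoidAlgebra.coeff_single_mul_apply, hincl, dif_neg, mul_zero]
    intro h
    rw [inv_inv] at h
    exact hx1 (eq_one_of_mem_X cs L ((Set.Finite.mem_toFinset _).1 hx)
      ((Subgroup.mul_mem_cancel_right _ u.2).1 h))
  · intro h
    exact absurd ((Set.Finite.mem_toFinset _).2 (one_mem_X cs L)) h

theorem xElt_mul_algIncl_injective :
    Function.Injective fun a => xElt cs.simple L * algIncl cs L a := by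
  intro a b h
  apply MonoidAlgebra.coeff_injective
  ext u
  rw [← coeff_xElt_mul_algIncl, ← coeff_xElt_mul_algIncl]
  exact congrArg (fun f => MonoidAlgebra.coeff f (u : W)) h

omit [Fintype B] [DecidableEq B] [Finite W] in
theorem algIncl_mul_single (a : MonoidAlgebra ℂ (parabolic cs L)) (u : parabolic cs L) :
    algIncl cs L (a * MonoidAlgebra.single u 1) =
      algIncl cs L a * MonoidAlgebra.single (u : W) 1 := by
  rw [map_mul]
  congr 1
  exact MonoidAlgebra.mapDomain_single

omit [Fintype B] [DecidableEq B] [Finite W] in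
theorem single_mul_algIncl (n : parabolicNormalizer cs L)
    (a : MonoidAlgebra ℂ (parabolic cs L)) :
    MonoidAlgebra.single (n : W) (1 : ℂ) * algIncl cs L a =
      algIncl cs L (MonoidAlgebra.mapDomainAlgHom ℂ ℂ
        ((parabolic cs L).normalizerMonoidHom n).toMonoidHom a) *
        MonoidAlgebra.single (n : W) (1 : ℂ) := by
  induction a using MonoidAlgebra.induction_linear with
  | zero => simp
  | add a b ha hb => simp only [map_add, mul_add, add_mul, ha, hb]
  | single u r =>
    have h : (((parabolic cs L).normalizerMonoidHom n u : parabolic cs L) : W) =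
        (n : W) * u * (n : W)⁻¹ := rfl
    simp [MonoidAlgebra.single_mul_single, -Subgroup.normalizerMonoidHom_apply_apply_coe, h]

/-- An element of `N_W(W_L)` that permutes the rays spanned by the simple roots of `W_L` fixes
`x_L`. -/
theorem xElt_mul_single {n : W}
    (hn : ∀ i ∈ L, ∃ r ∈ L, ∃ c : ℝ, 0 < c ∧ geomRep cs n (root i) = c • root r) :
    xElt cs.simple L * MonoidAlgebra.single n (1 : ℂ) = xElt cs.simple L := by
  -- Since x⁻¹ n = (n⁻¹ x)⁻¹, right multiplication by n permutes the summands of x_L as soon as n⁻¹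
  -- maps X_L to itself.
  have hmaps : Set.MapsTo (fun x => n⁻¹ * x) (X cs.simple L) (X cs.simple L) := by
    intro x hx
    rw [mem_X_iff] at hx ⊢
    intro i hi
    obtain ⟨r, hr, c, hc, h⟩ := hn i hi
    rw [mul_inv_rev, inv_inv, geomRep_mul_apply, h, map_smul]
    exact smul_nonneg hc.le (hx r hr)
  have hbij := ((Set.toFinite (X cs.simple L)).injOn_iff_bijOn_of_mapsTo hmaps).1
    (mul_right_injective n⁻¹).injOn
  have := AddMonoidHom.map_finsum_mem (s := X cs.simple L)
    (fun x => MonoidAlgebra.single x⁻¹ (1 : ℂ))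
    (AddMonoidHom.mulRight (MonoidAlgebra.single n (1 : ℂ))) (Set.toFinite _)
  refine this.trans (finsum_mem_eq_of_bijOn _ hbij fun x _ => ?_)
  simp [MonoidAlgebra.single_mul_single]

/-- The generator `e` of the top component of `ℂW_L` commutes with the elements of `N_W(W_L)` that
permute the rays spanned by the simple roots of `W_L`. -/
theorem single_mul_algIncl_eElt {n : W} (hnN : n ∈ parabolicNormalizer cs L)
    (hn : ∀ i ∈ L, ∃ r ∈ L, ∃ c : ℝ, 0 < c ∧ geomRep cs n (root i) = c • root r) :
    MonoidAlgebra.single n (1 : ℂ) *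
        algIncl cs L (eElt (parabolicSimple cs L) Finset.univ) =
      algIncl cs L (eElt (parabolicSimple cs L) Finset.univ) *
        MonoidAlgebra.single n (1 : ℂ) := by
  choose! r hrL c hc h using hn
  -- Two simple roots sent to the same ray would be proportional. So n induces a permutation of L,
  -- and conjugation by n permutes the simple reflections of W_L accordingly.
  have hinj : Function.Injective fun i : L => (⟨r i, hrL i i.2⟩ : L) := by
    intro i j hij
    have hr : r i = r j := congrArg Subtype.val hij
    have h1 : geomRep cs n (root (i : B)) = geomRep cs n ((c i / c j) • root (j : B)) := by
      rw [map_smul, h j j.2, h i i.2, hr, smul_smul, div_mul_cancel₀ _ (hc j j.2).ne']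
    have h2 := congrFun (rep_injective (geomRep cs) n h1) i
    by_contra hne
    have hne' : (i : B) ≠ j := fun h' => hne (Subtype.ext h')
    simp [root, hne'] at h2
  let σ : L ≃ L := Equiv.ofBijective _ (Finite.injective_iff_bijective.1 hinj)
  have hσ : ∀ i, (parabolic cs L).normalizerMonoidHom ⟨n, hnN⟩ (parabolicSimple cs L i) =
      parabolicSimple cs L (σ i) := fun i =>
    Subtype.ext (conj_simple_eq_of_geomRep_root_eq cs (h i i.2))
  have he := eElt_map hσ Finset.univ
  rw [Finset.map_univ_equiv] at he
  have h3 := single_mul_algIncl cs L ⟨n, hnN⟩ (eElt (parabolicSimple cs L) Finset.univ)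
  rw [he] at h3
  exact h3

/-- The embedding `a ↦ x_L a` of `ℂW_L` in `ℂW`. -/
def xEltMulIncl : MonoidAlgebra ℂ (parabolic cs L) →ₗ[ℂ] MonoidAlgebra ℂ W :=
  (LinearMap.mulLeft ℂ (xElt cs.simple L)).comp (algIncl cs L).toLinearMap

omit [Fintype B] [DecidableEq B] [Finite W] in
theorem xEltMulIncl_apply (a : MonoidAlgebra ℂ (parabolic cs L)) :
    xEltMulIncl cs L a = xElt cs.simple L * algIncl cs L a := rfl

/-- For u ∈ W_L and n permuting the rays of L, x_L e u n = x_L e n (n⁻¹ u n) = x_L n e (n⁻¹ u n) =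
x_L e (n⁻¹ u n), so passing from W_L to its normalizer adds nothing. -/
theorem map_cyclicSub_eElt :
    (cyclicSub (eElt (parabolicSimple cs L) Finset.univ) ⊤).map
        (xEltMulIncl cs L) =
      cyclicSub (xElt cs.simple L * algIncl cs L (eElt (parabolicSimple cs L) Finset.univ))
        (parabolicNormalizer cs L) := by
  rw [cyclicSub, Submodule.map_span, cyclicSub]
  congr 1
  ext a
  constructor
  · rintro ⟨_, ⟨u, -, rfl⟩, rfl⟩
    refine ⟨u, Subgroup.le_normalizer u.2, ?_⟩
    beta_reduce
    rw [mul_assoc, ← algIncl_mul_single, xEltMulIncl_apply]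
  · rintro ⟨g, hg, rfl⟩
    obtain ⟨u, hu, n, hnN, rfl, hn⟩ := exists_mul_eq_of_mem_normalizer cs L hg
    have hu' : n⁻¹ * u * n ∈ parabolic cs L := (Subgroup.mem_normalizer_iff''.1 hnN u).1 hu
    refine ⟨_, ⟨⟨n⁻¹ * u * n, hu'⟩, trivial, rfl⟩, ?_⟩
    have h1 : MonoidAlgebra.single (u * n) (1 : ℂ) =
        MonoidAlgebra.single n (1 : ℂ) * MonoidAlgebra.single (n⁻¹ * u * n) (1 : ℂ) := by
      rw [MonoidAlgebra.single_mul_single, mul_one]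
      congr 1
      group
    have h2 := algIncl_mul_single cs L (eElt (parabolicSimple cs L) Finset.univ)
      ⟨n⁻¹ * u * n, hu'⟩
    have h3 := single_mul_algIncl_eElt cs L hnN hn
    have h4 := xElt_mul_single cs L hn
    rw [xEltMulIncl_apply, h2]
    generalize algIncl cs L (eElt (parabolicSimple cs L) Finset.univ) = E at h3 ⊢
    generalize xElt cs.simple L = x at h4 ⊢
    beta_reduce
    rw [h1, mul_assoc x, ← mul_assoc E, ← h3, mul_assoc _ E,
      ← mul_assoc x (MonoidAlgebra.single n 1), h4]

omit [Fintype B] [DecidableEq B] [Finite W] in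
theorem xEltMulIncl_rightMul (g : parabolic cs L) (a : MonoidAlgebra ℂ (parabolic cs L)) :
    xEltMulIncl cs L (rightMul g a) = rightMul (g : W) (xEltMulIncl cs L a) := by
  rw [rightMul, rightMul, LinearMap.mulRight_apply, LinearMap.mulRight_apply, xEltMulIncl_apply,
    xEltMulIncl_apply, algIncl_mul_single, mul_assoc]

/-- The restriction of the extension of `Φ_L` to `W_L` is `Φ_L`. -/
theorem PhiTilde_eq_Phi (g : parabolic cs L) (hg : (g : W) ∈ parabolicNormalizer cs L) :
    PhiTilde cs L ⟨g, hg⟩ = Phi (parabolicSimple cs L) g :=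
  trace_restrict_map (xEltMulIncl cs L) (xElt_mul_algIncl_injective cs L) _ _
    (map_cyclicSub_eElt cs L) _ _ (fun a _ => xEltMulIncl_rightMul cs L g a) _ _

end TopComponent

/-! ### Induced class functions, Mackey's formula and indices -/

section Induction

variable {G K : Type*} [Group G] [Group K] [Finite G] [Finite K]

theorem ind_one (C : Subgroup G) (f : C → ℂ) (hf : f 1 = 1) : ind C f 1 = C.index := by
  classical
  have := Fintype.ofFinite G
  have h1 : ∀ x : G, (if h : x * 1 * x⁻¹ ∈ C then f ⟨x * 1 * x⁻¹, h⟩ else 0) = 1 := fun x => by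
    have e : x * 1 * x⁻¹ = 1 := by group
    simp only [e, one_mem, dif_pos]
    exact hf
  have h2 : (Nat.card C : ℂ) ≠ 0 := Nat.cast_ne_zero.2 Nat.card_pos.ne'
  rw [ind, finsum_congr h1, finsum_eq_sum_of_fintype, Finset.sum_const, Finset.card_univ,
    ← Nat.card_eq_fintype_card, ← C.card_mul_index, nsmul_eq_mul, mul_one, Nat.cast_mul,
    inv_mul_cancel_left₀ h2]

-- The group D acts simply transitively on the fibre by (c, k) ↦ (c j(d)⁻¹, d k).
omit [Finite G] [Finite K] in
theorem card_fiber_mul (j : K →* G) (C : Subgroup G) (D : Subgroup K) (hD : ∀ k, k ∈ D ↔ j k ∈ C)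
    {x : G} (hx : ∃ c ∈ C, ∃ k, x = c * j k) :
    Nat.card {p : C × K // (p.1 : G) * j p.2 = x} = Nat.card D := by
  obtain ⟨c, hc, k, rfl⟩ := hx
  symm
  refine Nat.card_eq_of_bijective (fun d : D => ⟨(⟨c * (j d)⁻¹, mul_mem hc
    (inv_mem ((hD d).1 d.2))⟩, d * k), ?_⟩) ⟨?_, ?_⟩
  · simp [mul_assoc]
  · intro d d' h
    have := congrArg (fun p => p.1.2) h
    exact Subtype.ext (mul_right_cancel this)
  · rintro ⟨⟨c', k'⟩, h⟩
    have h' : (c' : G) * j k' = c * j k := h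
    have h1 : j (k' * k⁻¹) = (c' : G)⁻¹ * c := by
      rw [map_mul, map_inv, mul_inv_eq_iff_eq_mul, mul_assoc, ← h', inv_mul_cancel_left]
    have h2 : k' * k⁻¹ ∈ D := (hD _).2 (h1 ▸ mul_mem (inv_mem c'.2) hc)
    refine ⟨⟨k' * k⁻¹, h2⟩, Subtype.ext (Prod.ext (Subtype.ext ?_) ?_)⟩
    · change c * (j (k' * k⁻¹))⁻¹ = c'
      rw [h1]; group
    · exact inv_mul_cancel_right k' k

/-- Mackey's formula for a single double coset. -/
theorem ind_apply_of_forall_eq_mul (j : K →* G) (C : Subgroup G) (D : Subgroup K)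
    (hD : ∀ k, k ∈ D ↔ j k ∈ C) (hG : ∀ x : G, ∃ c ∈ C, ∃ k, x = c * j k)
    (f : C → ℂ) (hf : ∀ c d : C, f (c * d * c⁻¹) = f d) (f' : D → ℂ)
    (hf' : ∀ d : D, f' d = f ⟨j d, (hD d).1 d.2⟩) (k : K) : ind C f (j k) = ind D f' k := by
  classical
  have := Fintype.ofFinite G
  have := Fintype.ofFinite K
  set F : G → ℂ := fun x => if h : x * j k * x⁻¹ ∈ C then f ⟨x * j k * x⁻¹, h⟩ else 0 with hF
  have hFc : ∀ c ∈ C, ∀ x, F (c * x) = F x := by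
    intro c hc x
    have e : c * x * j k * (c * x)⁻¹ = c * (x * j k * x⁻¹) * c⁻¹ := by group
    have hiff : c * x * j k * (c * x)⁻¹ ∈ C ↔ x * j k * x⁻¹ ∈ C := by
      rw [e, C.mul_mem_cancel_right (inv_mem hc), C.mul_mem_cancel_left hc]
    simp only [hF]
    by_cases h : x * j k * x⁻¹ ∈ C
    · rw [dif_pos h, dif_pos (hiff.2 h), ← hf ⟨c, hc⟩ ⟨x * j k * x⁻¹, h⟩]
      congr 1
      exact Subtype.ext e
    · rw [dif_neg h, dif_neg (mt hiff.1 h)]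
  have hFj : ∀ y : K, F (j y) =
      if h : y * k * y⁻¹ ∈ D then f' ⟨y * k * y⁻¹, h⟩ else 0 := by
    intro y
    have e : j y * j k * (j y)⁻¹ = j (y * k * y⁻¹) := by simp
    have hiff : j y * j k * (j y)⁻¹ ∈ C ↔ y * k * y⁻¹ ∈ D := by rw [e, hD]
    simp only [hF]
    by_cases h : y * k * y⁻¹ ∈ D
    · rw [dif_pos h, dif_pos (hiff.2 h), hf']
      congr 1
      exact Subtype.ext e
    · rw [dif_neg h, dif_neg (mt hiff.1 h)]
  -- The sum of F(c j(k)) over C × K is computed twice: along the fibres of (c, k) ↦ c j(k), and by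
  -- the invariance of F under left multiplication by C.
  have hsum : ∑ p : C × K, F (p.1 * j p.2) = (Nat.card D : ℂ) * ∑ x, F x := by
    rw [← Finset.sum_fiberwise Finset.univ (fun p : C × K => (p.1 : G) * j p.2), Finset.mul_sum]
    refine Finset.sum_congr rfl fun x _ => ?_
    have h1 : ∀ p ∈ Finset.univ.filter (fun p : C × K => (p.1 : G) * j p.2 = x),
        F (p.1 * j p.2) = F x := fun p hp => by rw [(Finset.mem_filter.1 hp).2]
    rw [Finset.sum_congr rfl h1, Finset.sum_const, nsmul_eq_mul, ← card_fiber_mul j C D hD (hG x),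
      Nat.card_eq_fintype_card, Fintype.card_subtype]
  have hsum' : ∑ p : C × K, F (p.1 * j p.2) = (Nat.card C : ℂ) * ∑ y : K, F (j y) := by
    rw [Fintype.sum_prod_type, Finset.sum_congr rfl fun (c : C) _ =>
      Finset.sum_congr rfl fun y _ => hFc c c.2 (j y), Finset.sum_const, Finset.card_univ,
      nsmul_eq_mul, Nat.card_eq_fintype_card]
  have hC : (Nat.card C : ℂ) ≠ 0 := Nat.cast_ne_zero.2 Nat.card_pos.ne'
  have hD0 : (Nat.card D : ℂ) ≠ 0 := Nat.cast_ne_zero.2 Nat.card_pos.ne'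
  rw [ind, ind, finsum_eq_sum_of_fintype, finsum_eq_sum_of_fintype,
    ← Finset.sum_congr rfl fun y _ => hFj y]
  change (Nat.card C : ℂ)⁻¹ * ∑ x, F x = _
  rw [hsum] at hsum'
  field_simp
  linear_combination hsum'

omit [Finite K] in
/-- The index of the preimage of a subgroup is at most the index of the subgroup, with equality
only if there is just one double coset. -/
theorem index_le_and_forall_eq_mul (j : K →* G) (C : Subgroup G) (D : Subgroup K)
    (hD : ∀ k, k ∈ D ↔ j k ∈ C) :
    D.index ≤ C.index ∧ (C.index ≤ D.index → ∀ x : G, ∃ c ∈ C, ∃ k, x = c * j k) := by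
  have hrel : ∀ a b : K, a⁻¹ * b ∈ D ↔ (j a)⁻¹ * j b ∈ C := fun a b => by
    rw [hD, map_mul, map_inv]
  let q : K ⧸ D → G ⧸ C := Quotient.lift (fun k => (j k : G ⧸ C)) fun a b hab =>
    QuotientGroup.eq.2 ((hrel a b).1 (QuotientGroup.leftRel_apply.1 hab))
  have hq : Function.Injective q := by
    intro a b
    induction a using QuotientGroup.induction_on with | H a => ?_
    induction b using QuotientGroup.induction_on with | H b => ?_
    intro h
    exact QuotientGroup.eq.2 ((hrel a b).2 (QuotientGroup.eq.1 h))
  refine ⟨Nat.card_le_card_of_injective q hq, fun hle x => ?_⟩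
  -- The quotients consist of left cosets, so surjectivity is applied to x⁻¹: from x⁻¹ ∈ j(y) C
  -- follows x ∈ C j(y⁻¹).
  obtain ⟨y, hy⟩ := (hq.bijective_of_nat_card_le hle).2 (x⁻¹ : G)
  induction y using QuotientGroup.induction_on with | H y => ?_
  have h : (j y)⁻¹ * x⁻¹ ∈ C := QuotientGroup.eq.1 hy
  exact ⟨_, inv_mem h, y⁻¹, by simp⟩

theorem card_carrier_le_index_centralizer (w : G) {C : ConjClasses G} (hw : w ∈ C.carrier) :
    Nat.card C.carrier ≤ (Subgroup.centralizer {w}).index := by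
  have hex : ∀ x : C.carrier, ∃ g : G, g * w * g⁻¹ = x := fun x => by
    have h1 := ConjClasses.mem_carrier_iff_mk_eq.1 hw
    have h2 := ConjClasses.mem_carrier_iff_mk_eq.1 x.2
    exact isConj_iff.1 (ConjClasses.mk_eq_mk_iff_isConj.1 (h1.trans h2.symm))
  choose g hg using hex
  refine Nat.card_le_card_of_injective
    (fun x => (g x : G ⧸ Subgroup.centralizer {w})) fun x y h => ?_
  have h1 := Subgroup.mem_centralizer_singleton_iff.1 (QuotientGroup.eq.1 h)
  apply Subtype.ext
  rw [← hg x, ← hg y]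
  have h2 : g y = g x * ((g x)⁻¹ * g y) := by group
  have h3 : g x * w * (g x)⁻¹ = g x * (w * ((g x)⁻¹ * g y)) * (g y)⁻¹ := by group
  rw [h3]
  rw [← h1]
  group

end Induction

/-! ### Cuspidal classes and the factorization of the normalizer -/

section Cuspidal

variable {B W : Type*} [Fintype B] [DecidableEq B] [Group W] [Finite W] {M : CoxeterMatrix B}
variable (cs : CoxeterSystem M W) (L : Finset B)

instance : Finite (CuspidalClass (parabolicRep cs L)) :=
  have : Finite (ConjClasses (parabolic cs L)) := Quotient.finite _
  inferInstanceAs (Finite {C : ConjClasses (parabolic cs L) //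
    ∀ g ∈ C.carrier, IsCuspidal (parabolicRep cs L) g})

omit [Finite W] in
theorem IsCuspidal.of_isConj {g h : parabolic cs L} (hg : IsCuspidal (parabolicRep cs L) g)
    (hc : IsConj g h) : IsCuspidal (parabolicRep cs L) h := by
  obtain ⟨x, rfl⟩ := isConj_iff.1 hc
  have := fixedSpace_conj (parabolicRep cs L) x⁻¹ g
  rw [inv_inv] at this
  rw [IsCuspidal, this, hg, Submodule.comap_bot, LinearMap.ker_eq_bot]
  exact rep_injective _ _

theorem isCuspidal_iff (g : parabolic cs L) : IsCuspidal (parabolicRep cs L) g ↔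
    fixedSpace (geomRep cs) (g : W) = fixedBy (geomRep cs) (parabolic cs L) :=
  eq_bot_iff_eq_fixedBy cs L (fun _ => mem_fixedSpace_parabolicRep cs L)
    (fixedBy_le_fixedSpace cs L g.2)

/-- An element with fixed space Fix(W_L) lies in W_L by `mem_parabolic_of_fixedBy_le` and is
cuspidal there, so it belongs to a cuspidal class. -/
theorem card_fixedSpace_eq_le [Fintype (CuspidalClass (parabolicRep cs L))] :
    Nat.card {w : W // fixedSpace (geomRep cs) w = fixedBy (geomRep cs) (parabolic cs L)} ≤
      ∑ C : CuspidalClass (parabolicRep cs L), Nat.card C.1.carrier := by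
  rw [← Nat.card_sigma]
  let lift : {w : W // fixedSpace (geomRep cs) w = fixedBy (geomRep cs) (parabolic cs L)} →
      parabolic cs L := fun w => ⟨w.1, mem_parabolic_of_fixedBy_le cs L w.2.ge⟩
  have hcusp : ∀ w, IsCuspidal (parabolicRep cs L) (lift w) := fun w =>
    (isCuspidal_iff cs L (lift w)).2 w.2
  refine Nat.card_le_card_of_injective
    (fun w => (⟨⟨ConjClasses.mk (lift w), fun g hg => (hcusp w).of_isConj cs L
      (ConjClasses.mk_eq_mk_iff_isConj.1 (ConjClasses.mem_carrier_iff_mk_eq.1 hg).symm)⟩,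
      ⟨lift w, ConjClasses.mem_carrier_mk⟩⟩ :
        Σ C : CuspidalClass (parabolicRep cs L), C.1.carrier)) fun w w' h => ?_
  have h1 := congrArg (fun p : Σ C : CuspidalClass (parabolicRep cs L), C.1.carrier =>
    ((p.2 : parabolic cs L) : W)) h
  exact Subtype.ext h1

theorem finrank_osComponent_fixedBy_le [Fintype (CuspidalClass (parabolicRep cs L))] :
    Module.finrank ℂ (osComponent cs.simple (geomRep cs)
      (fixedBy (geomRep cs) (parabolic cs L))) ≤
      ∑ C : CuspidalClass (parabolicRep cs L), Nat.card C.1.carrier := by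
  classical
  have := Fintype.ofFinite W
  refine le_trans ?_ (card_fixedSpace_eq_le cs L)
  rw [Nat.card_eq_fintype_card, Fintype.card_subtype]
  exact (finrank_osComponent_le cs _ _ (finrank_parabolicSpace_add cs L)).2

omit [Finite W] in
theorem osAct_one (a : OSAlgebra cs.simple (geomRep cs)) :
    osAct cs.simple (geomRep cs) 1 a = a := by
  have h : osAct cs.simple (geomRep cs) 1 = AlgHom.id ℂ _ := by
    refine RingQuot.ringQuot_ext' ℂ _ _ ?_
    refine FreeAlgebra.hom_ext (funext fun t => ?_)
    have h1 : osMonomial cs.simple (geomRep cs) [t] =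
        RingQuot.mkAlgHom ℂ _ (FreeAlgebra.ι ℂ t) := by simp [osMonomial, monomial]
    have h2 : t.conj 1 = t := Subtype.ext (by simp [Refl.conj])
    simp only [Function.comp_apply, AlgHom.comp_apply, AlgHom.id_apply]
    rw [← h1, osAct_osMonomial, List.map_singleton, h2]
  exact congrArg (fun f => f a) h

theorem trace_restrict_of_forall_eq {K E : Type*} [Field K] [AddCommGroup E] [Module K E]
    (P : Submodule K E) [Module.Finite K P] (φ : E →ₗ[K] E) (h : ∀ x, φ x = x)
    (hφ : ∀ x ∈ P, φ x ∈ P) :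
    LinearMap.trace K P (φ.restrict hφ) = Module.finrank K P := by
  have : φ.restrict hφ = 1 := LinearMap.ext fun x => Subtype.ext (h x)
  rw [this, LinearMap.trace_one]

theorem PsiTilde_one : PsiTilde cs L 1 = Module.finrank ℂ (osComponent cs.simple (geomRep cs)
    (fixedBy (geomRep cs) (parabolic cs L))) := by
  classical
  have := Fintype.ofFinite W
  have := (finrank_osComponent_le cs _ _ (finrank_parabolicSpace_add cs L)).1
  exact trace_restrict_of_forall_eq _ _ (osAct_one cs) _

/-! ### Sign and determinant on `W_L` -/

omit [Fintype B] [DecidableEq B] [Finite W] in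
theorem sign_prod (ω : List B) : sign cs.simple (ω.map cs.simple).prod = (-1) ^ ω.length := by
  have h : ∀ g : W, sign cs.simple g = (-1) ^ cs.length g := fun g => by
    rw [sign, wordLength_simple]
  have hmul : ∀ i g, sign cs.simple (cs.simple i * g) = -sign cs.simple g := by
    intro i g
    rw [h, h]
    rcases cs.length_simple_mul g i with h' | h'
    · rw [h', pow_succ, mul_neg_one]
    · rw [← h', pow_succ, mul_neg_one, neg_neg]
  induction ω with
  | nil => simp [h]
  | cons i ω ih => rw [List.map_cons, List.prod_cons, hmul, ih, List.length_cons, pow_succ,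
      mul_neg_one]

omit [Fintype B] [DecidableEq B] [Finite W] in
theorem exists_word_parabolic (g : parabolic cs L) :
    ∃ ω : List L, (ω.map (parabolicSimple cs L)).prod = g := by
  have hind : ∀ g (hg : g ∈ parabolic cs L),
      ∃ ω : List L, ((ω.map (parabolicSimple cs L)).prod : W) = g := by
    intro g hg
    induction hg using Subgroup.closure_induction'' with
    | one => exact ⟨[], by simp⟩
    | mem x hx =>
      obtain ⟨i, hi, rfl⟩ := hx
      exact ⟨[⟨i, hi⟩], by simp [parabolicSimple]⟩
    | inv_mem x hx =>
      obtain ⟨i, hi, rfl⟩ := hx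
      exact ⟨[⟨i, hi⟩], by simp [parabolicSimple]⟩
    | mul x y _ _ hx hy =>
      obtain ⟨ω, rfl⟩ := hx
      obtain ⟨ω', rfl⟩ := hy
      exact ⟨ω ++ ω', by simp⟩
  obtain ⟨ω, h⟩ := hind g g.2
  exact ⟨ω, Subtype.ext h⟩

-- The sign can be read off from any word, so a shortest word in L computes both sides; equality of
-- the two length functions is not needed.
omit [Fintype B] [DecidableEq B] [Finite W] in
theorem sign_parabolic (g : parabolic cs L) :
    sign (parabolicSimple cs L) g = sign cs.simple (g : W) := by
  obtain ⟨ω₀, h₀⟩ := exists_word_parabolic cs L g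
  obtain ⟨ω, h1, h2⟩ := Nat.sInf_mem
    (s := {n | ∃ ω : List L, ω.length = n ∧ (ω.map (parabolicSimple cs L)).prod = g})
    ⟨_, ω₀, rfl, h₀⟩
  have h3 : (g : W) = ((ω.map Subtype.val).map cs.simple).prod := by
    rw [← h2, ← Subgroup.coe_subtype, map_list_prod, List.map_map, List.map_map]
    rfl
  rw [h3, sign_prod, List.length_map, h1, sign, wordLength]

omit [Finite W] in
theorem alpha_eq_one (g : parabolic cs L) (hg : (g : W) ∈ parabolicNormalizer cs L) :
    alpha (geomRep cs) (parabolic cs L) ⟨g, hg⟩ = 1 := by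
  have h : (geomRep cs (g : W)).restrict (rep_mem_fixedBy (geomRep cs) (parabolic cs L) ⟨g, hg⟩) =
      1 := LinearMap.ext fun v => Subtype.ext (mem_fixedBy.1 v.2 g g.2)
  rw [alpha, h, map_one, Complex.ofReal_one]

/-! ### Restriction of the induced characters -/

/-- The inclusion `W_L → N_W(W_L)`. -/
def toNormalizerHom : parabolic cs L →* parabolicNormalizer cs L :=
  Subgroup.inclusion Subgroup.le_normalizer

omit [Fintype B] [DecidableEq B] [Finite W] in
theorem mem_centralizer_iff_toNormalizerHom (w k : parabolic cs L) :
    k ∈ Subgroup.centralizer {w} ↔ toNormalizerHom cs L k ∈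
      (Subgroup.centralizer {(w : W)}).subgroupOf (parabolicNormalizer cs L) := by
  rw [Subgroup.mem_subgroupOf, Subgroup.mem_centralizer_singleton_iff,
    Subgroup.mem_centralizer_singleton_iff, Subtype.ext_iff]
  rfl

variable {cs L} {w : CuspidalClass (parabolicRep cs L) → parabolic cs L}
  {φ ψ : ∀ C, Subgroup.centralizer {(w C : W)} →* ℂˣ}

/-- The decomposition of the extension of `Ψ_L` forces `N_W(W_L) = C_W(w_C) W_L`. -/
theorem SatisfiesC.exists_eq_mul (hw : ∀ C, w C ∈ C.1.carrier) (hC : SatisfiesC cs L w φ ψ)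
    (C : CuspidalClass (parabolicRep cs L)) (x : parabolicNormalizer cs L) :
    ∃ c ∈ (Subgroup.centralizer {(w C : W)}).subgroupOf (parabolicNormalizer cs L),
      ∃ k, x = c * toNormalizerHom cs L k := by
  have := Fintype.ofFinite (CuspidalClass (parabolicRep cs L))
  let CN : ∀ _ : CuspidalClass (parabolicRep cs L), Subgroup (parabolicNormalizer cs L) :=
    fun C => (Subgroup.centralizer {(w C : W)}).subgroupOf (parabolicNormalizer cs L)
  have hidx := fun C => index_le_and_forall_eq_mul (toNormalizerHom cs L) (CN C)
    (Subgroup.centralizer {w C}) (mem_centralizer_iff_toNormalizerHom cs L (w C))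
  -- The decomposition of Ψ evaluated at 1: the degrees of the induced characters add up to dim A_Y.
  have hsum : ∑ C, (CN C).index = Module.finrank ℂ (osComponent cs.simple (geomRep cs)
      (fixedBy (geomRep cs) (parabolic cs L))) := by
    have h := hC.psi 1
    rw [PsiTilde_one, finsum_eq_sum_of_fintype, Finset.sum_congr rfl fun C _ =>
      ind_one (CN C) (toNormalizer cs L (ψ C)) (by
        change ((ψ C 1 : ℂˣ) : ℂ) = 1
        rw [map_one, Units.val_one])] at h
    exact_mod_cast h.symm
  have hle : ∑ C, (CN C).index ≤ ∑ C, (Subgroup.centralizer {w C}).index :=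
    hsum.le.trans ((finrank_osComponent_fixedBy_le cs L).trans
      (Finset.sum_le_sum fun C _ => card_carrier_le_index_centralizer (w C) (hw C)))
  -- The index inequality holds for each class and the sums agree, so it is an equality for each
  -- class; equal indices mean a single double coset.
  have heq := (Finset.sum_eq_sum_iff_of_le fun C _ => (hidx C).1).1
    (le_antisymm (Finset.sum_le_sum fun C _ => (hidx C).1) hle)
  exact (hidx C).2 (heq C (Finset.mem_univ C)).ge x

/-- Mackey's formula with one double coset. The hypothesis on Ψ enters only through the
factorization of N, so the same lemma serves both φ and ψ. -/
theorem SatisfiesC.ind_toNormalizer (hw : ∀ C, w C ∈ C.1.carrier) (hC : SatisfiesC cs L w φ ψ)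
    (C : CuspidalClass (parabolicRep cs L)) (χ : Subgroup.centralizer {(w C : W)} →* ℂˣ)
    (g : parabolic cs L) :
    ind ((Subgroup.centralizer {(w C : W)}).subgroupOf (parabolicNormalizer cs L))
      (toNormalizer cs L χ) (toNormalizerHom cs L g) =
    ind (Subgroup.centralizer {w C}) (fun c => (χ.comp (centralizerInclusion (w C)) c : ℂ)) g := by
  refine ind_apply_of_forall_eq_mul (toNormalizerHom cs L) _ _
    (mem_centralizer_iff_toNormalizerHom cs L (w C)) (hC.exists_eq_mul hw C) _
    (fun c d => ?_) _ (fun d => rfl) g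
  let r : (Subgroup.centralizer {(w C : W)}).subgroupOf (parabolicNormalizer cs L) →*
      Subgroup.centralizer {(w C : W)} :=
    { toFun := fun c => ⟨((c : parabolicNormalizer cs L) : W), Subgroup.mem_subgroupOf.1 c.2⟩
      map_one' := rfl
      map_mul' := fun _ _ => rfl }
  change ((χ (r (c * d * c⁻¹)) : ℂˣ) : ℂ) = ((χ (r d) : ℂˣ) : ℂ)
  rw [map_mul, map_mul, map_inv, map_mul, map_mul, map_inv, mul_inv_cancel_comm]

end Cuspidal

end FinCoxeter

end

/-- If the linear characters `φ C` and `ψ C` of the centralizers `C_W(w_C)` decompose the extended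
top characters of `W_L` as in the relative conjecture for `L ⊆ S`, then their restrictions to the
centralizers `C_{W_L}(w_C)` decompose the top characters of `W_L`. -/
theorem mainTheorem7 {B W : Type*} [Fintype B] [DecidableEq B] [Group W] [Finite W]
    {M : CoxeterMatrix B} (cs : CoxeterSystem M W) (L : Finset B)
    (w : FinCoxeter.CuspidalClass (FinCoxeter.parabolicRep cs L) → FinCoxeter.parabolic cs L)
    (hw : ∀ C, w C ∈ C.1.carrier)
    (φ ψ : ∀ C, Subgroup.centralizer {(w C : W)} →* ℂˣ)
    (hC : FinCoxeter.SatisfiesC cs L w φ ψ) :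
    FinCoxeter.SatisfiesB (FinCoxeter.parabolicSimple cs L) (FinCoxeter.parabolicRep cs L) w
      (fun C => (φ C).comp (FinCoxeter.centralizerInclusion (w C)))
      (fun C => (ψ C).comp (FinCoxeter.centralizerInclusion (w C))) where
  phi g := by
    rw [← FinCoxeter.PhiTilde_eq_Phi cs L g (Subgroup.le_normalizer g.2)]
    exact (hC.phi (FinCoxeter.toNormalizerHom cs L g)).trans
      (finsum_congr fun C => hC.ind_toNormalizer hw C (φ C) g)
  psi g := by
    rw [← FinCoxeter.PsiTilde_eq_Psi cs L g (Subgroup.le_normalizer g.2)]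
    exact (hC.psi (FinCoxeter.toNormalizerHom cs L g)).trans
      (finsum_congr fun C => hC.ind_toNormalizer hw C (ψ C) g)
  twist C c := by
    have h := hC.twist C (FinCoxeter.centralizerInclusion (w C) c)
      (Subgroup.le_normalizer (c : FinCoxeter.parabolic cs L).2)
    rw [FinCoxeter.sign_parabolic]
    have h1 := FinCoxeter.alpha_eq_one cs L c (Subgroup.le_normalizer c.1.2)
    exact h.trans ((congrArg _ h1).trans (mul_one _))
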